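/- All graphs are finite and simple. A drawing of a graph in the plane maps the vertices to distinct points and each edge to a simple continuous arc joining its ends and containing no other vertex. Drawings are good: edges with a common end do not cross, two edges cross at most once, every common point of two edges other than a common end is a proper crossing, and no three edges cross at one point. A $1$-plane graph is a graph together with a good drawing in which each edge is crossed at most once; an edge is non-crossing if no edge crosses it. The faces of a $1$-plane graph are the connected components of the complement of its drawing. A $1$-plane graph $G$ with $|V(G)|\ge 3$ is optimal if $|E(G)|=4|V(G)|-8$. Let $G_1,G_2$ be $1$-plane graphs with non-crossing edges $e_1,e_2$, respectively. An edge merging of $G_1$ and $G_2$ along $e_1,e_2$ is a $1$-plane graph obtained as follows: redraw $G_2$, by a homeomorphism of the sphere, so that $e_2$ lies on the boundary of the infinite face; choose a face $F$ of $G_1$ whose boundary contains $e_1$; insert $G_2$ into $F$ and merge $e_1$ and $e_2$ (with their ends) into a single edge, so that the two graphs share exactly this edge and its two ends. The class of quasi-optimal $1$-plane graphs is the smallest class that contains all optimal $1$-plane graphs and is closed under edge merging. Theorem. For $n=14$ and for every integer $n\ge 16$ there exists a quasi-optimal $1$-plane graph with $n$ vertices, exactly two of which have odd degree. -/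

import Mathlib

/-- The plane. -/
abbrev Plane : Type := ℝ × ℝ

/-- `S` is a simple continuous arc in the plane joining `p` and `q`. -/
def IsArc (p q : Plane) (S : Set Plane) : Prop :=
  ∃ γ : Path p q, Function.Injective γ ∧ Set.range γ = S

/-- The sets `S` and `T` cross (and do not merely touch) at `x`: in suitable local coordinates
around `x` they are the two coordinate axes. -/
def CrossTransversally (S T : Set Plane) (x : Plane) : Prop :=
  ∃ φ : OpenPartialHomeomorph Plane Plane, x ∈ φ.source ∧ φ x = 0 ∧
    ∀ y ∈ φ.source, (y ∈ S ↔ (φ y).2 = 0) ∧ (y ∈ T ↔ (φ y).1 = 0)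

/-- A drawing of a simple graph in the plane: distinct points for the vertices, and for each edge
a simple arc joining its ends and passing through no other vertex. The value of `arc` at a pair
that is not an edge is irrelevant. -/
structure Drawing {V : Type} (G : SimpleGraph V) where
  point : V → Plane
  arc : Sym2 V → Set Plane
  point_injective : Function.Injective point
  isArc : ∀ u v : V, G.Adj u v → IsArc (point u) (point v) (arc s(u, v))
  mem_of_point_mem : ∀ e ∈ G.edgeSet, ∀ w : V, point w ∈ arc e → w ∈ e

namespace Drawing

variable {V : Type} {G : SimpleGraph V}

/-- The distinct edges `e` and `f` meet at the point `x`, which is not a vertex. -/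
def CrossAt (D : Drawing G) (e f : Sym2 V) (x : Plane) : Prop :=
  e ∈ G.edgeSet ∧ f ∈ G.edgeSet ∧ e ≠ f ∧ x ∈ D.arc e ∧ x ∈ D.arc f ∧ x ∉ Set.range D.point

/-- Good drawings: edges with a common end do not cross, two edges cross at most once, every
common point of two edges other than a common end is a proper crossing, and no three edges cross
at the same point. (That no edge crosses itself is part of `Drawing`.) -/
structure IsGood (D : Drawing G) : Prop where
  not_cross_of_incident : ∀ e f : Sym2 V, ∀ w : V, w ∈ e → w ∈ f → ∀ x, ¬ D.CrossAt e f x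
  cross_at_most_once : ∀ e f : Sym2 V, ∀ x y, D.CrossAt e f x → D.CrossAt e f y → x = y
  transversal : ∀ e f : Sym2 V, ∀ x, D.CrossAt e f x → CrossTransversally (D.arc e) (D.arc f) x
  no_triple : ∀ e f g : Sym2 V, ∀ x, D.CrossAt e f x → D.CrossAt e g x → f = g

/-- Each edge is crossed at most once. -/
def IsOnePlanar (D : Drawing G) : Prop :=
  ∀ e f g : Sym2 V, ∀ x y, D.CrossAt e f x → D.CrossAt e g y → f = g ∧ x = y

/-- The edge `e` is not crossed by any edge. -/
def NonCrossing (D : Drawing G) (e : Sym2 V) : Prop :=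
  e ∈ G.edgeSet ∧ ∀ f x, ¬ D.CrossAt e f x

/-- The set of all points of the drawing. -/
def image (D : Drawing G) : Set Plane :=
  Set.range D.point ∪ ⋃ e ∈ G.edgeSet, D.arc e

/-- The faces of the plane graph obtained by turning every crossing into a vertex: the connected
components of the complement of the drawing. -/
def IsFace (D : Drawing G) (F : Set Plane) : Prop :=
  ∃ x ∈ D.imageᶜ, F = connectedComponentIn D.imageᶜ x

/-- Two drawings of the same graph correspond to each other under a homeomorphism of the sphere,
viewed as the one-point compactification of the plane. -/
def SphereEquivalent (D D' : Drawing G) : Prop :=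
  ∃ h : OnePoint Plane ≃ₜ OnePoint Plane,
    (∀ v : V, h (D.point v) = (D'.point v : OnePoint Plane)) ∧
    ∀ e ∈ G.edgeSet, h '' ((fun p : Plane => (p : OnePoint Plane)) '' D.arc e) =
      (fun p : Plane => (p : OnePoint Plane)) '' D'.arc e

end Drawing

/-- A 1-plane graph: a finite simple graph with a good 1-planar drawing. -/
structure OnePlaneGraph (V : Type) where
  finite : Finite V
  graph : SimpleGraph V
  drawing : Drawing graph
  good : drawing.IsGood
  onePlanar : drawing.IsOnePlanar

namespace OnePlaneGraph

/-- Optimal: exactly `4 n - 8` edges, where `n ≥ 3` is the number of vertices. -/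
def IsOptimal {V : Type} (G : OnePlaneGraph V) : Prop :=
  3 ≤ Nat.card V ∧ G.graph.edgeSet.ncard + 8 = 4 * Nat.card V

/-- `G` is an edge merging of `G₁` and `G₂` along the non-crossing edges `e₁ = u₁v₁` and
`e₂ = u₂v₂`. First `G₂` is redrawn, by a homeomorphism of the sphere, as a drawing `D₂` that has
`e₂` on the boundary of its infinite face `F₂`. Then `D₂` is inserted into a face `F` of `G₁` with
`e₁` on its boundary, the edges `e₁` and `e₂` becoming one. The maps `f₁` and `f₂` are the
inclusions of the two vertex sets. -/
def IsEdgeMerging {V₁ V₂ V : Type} (G₁ : OnePlaneGraph V₁) (G₂ : OnePlaneGraph V₂)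
    (G : OnePlaneGraph V) : Prop :=
  ∃ (u₁ v₁ : V₁) (u₂ v₂ : V₂) (f₁ : V₁ ↪ V) (f₂ : V₂ ↪ V) (D₂ : Drawing G₂.graph)
    (F₂ F : Set Plane),
    G₁.drawing.NonCrossing s(u₁, v₁) ∧ G₂.drawing.NonCrossing s(u₂, v₂) ∧
    -- the drawing of `G₂` to be inserted
    G₂.drawing.SphereEquivalent D₂ ∧
    D₂.IsFace F₂ ∧ ¬ Bornology.IsBounded F₂ ∧ D₂.arc s(u₂, v₂) ⊆ frontier F₂ ∧
    -- the face of `G₁` into which it is inserted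
    G₁.drawing.IsFace F ∧ G₁.drawing.arc s(u₁, v₁) ⊆ frontier F ∧
    D₂.arc s(u₂, v₂) = G₁.drawing.arc s(u₁, v₁) ∧
    D₂.image \ D₂.arc s(u₂, v₂) ⊆ F ∧
    -- the graph `G` is the union of the two graphs, which share only the merged edge
    f₁ u₁ = f₂ u₂ ∧ f₁ v₁ = f₂ v₂ ∧
    Set.range f₁ ∪ Set.range f₂ = Set.univ ∧
    Set.range f₁ ∩ Set.range f₂ = {f₁ u₁, f₁ v₁} ∧
    G.graph = G₁.graph.map f₁ ⊔ G₂.graph.map f₂ ∧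
    -- the drawing of `G` is the union of the two drawings
    (∀ w, G.drawing.point (f₁ w) = G₁.drawing.point w) ∧
    (∀ w, G.drawing.point (f₂ w) = D₂.point w) ∧
    (∀ e ∈ G₁.graph.edgeSet, G.drawing.arc (e.map f₁) = G₁.drawing.arc e) ∧
    (∀ e ∈ G₂.graph.edgeSet, G.drawing.arc (e.map f₂) = D₂.arc e)

/-- Quasi-optimal 1-plane graphs: those obtained from optimal 1-plane graphs by finitely many
edge mergings. -/
inductive IsQuasiOptimal : ∀ {V : Type}, OnePlaneGraph V → Prop
  | optimal {V : Type} (G : OnePlaneGraph V) : G.IsOptimal → IsQuasiOptimal G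
  | merging {V₁ V₂ V : Type} (G₁ : OnePlaneGraph V₁) (G₂ : OnePlaneGraph V₂)
      (G : OnePlaneGraph V) : IsQuasiOptimal G₁ → IsQuasiOptimal G₂ → IsEdgeMerging G₁ G₂ G →
      IsQuasiOptimal G

end OnePlaneGraph

/-! Merging along an edge identifies two pairs of vertices and one pair of edges, so an end of the
merged edge gets degree d₁ + d₂ - 1, while every other degree is unchanged. Hence merging a graph
with all degrees even flips the parity of the degree at the two ends of the merged edge and nowhere
else (`MergeData.oddVertices_merge`).

The building blocks are four optimal graphs with all degrees even, on 8, 10, 11 and 12 vertices. Two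
of them merged have exactly two odd vertices. If a further block is merged along an edge vw with v
odd and w even, then v becomes even and w odd, so the number stays two. Merging a block on k + 2
vertices adds k vertices. Two blocks give 14, 16, 17, 18, 19 and 21 vertices, one number in each
residue class modulo 6; merging cubes (k = 6) then reaches every admissible n (`extendable_of_ge`).

The geometry is reduced to finite checks on integer coordinates (`Tile.Valid`). Each block is drawn
inside a triangle whose base 01 is an edge, and an uncrossed edge from vertex 1 to another vertex is
a side of a small triangle, the slot, that the drawing avoids. An affine map carries the big
triangle of a new block onto the slot of the graph built so far (`HasSlot.exists_merging`). The slot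
of the new block survives in the merged drawing. It starts at the image of vertex 1, which is the
vertex w that has just become odd, and ends at a new vertex, which is even, so the step can be
repeated. -/

open Set Topology

/-! ### Plane geometry -/

/-- Twice the signed area of the triangle `abc`. -/
def orient {R : Type} [CommRing R] (a b c : R × R) : R :=
  (b.1 - a.1) * (c.2 - a.2) - (b.2 - a.2) * (c.1 - a.1)

/-- The signed area is affine in its last argument. All incidence arguments for segments and
triangles below rest on this. -/
theorem orient_combo (a b x y : Plane) {s t : ℝ} (h : s + t = 1) :
    orient a b (s • x + t • y) = s * orient a b x + t * orient a b y := by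
  obtain rfl : s = 1 - t := by linarith
  simp only [orient, Prod.fst_add, Prod.snd_add, Prod.smul_fst, Prod.smul_snd, smul_eq_mul]
  ring

theorem orient_eq_zero_of_mem_segment {a b x : Plane} (hx : x ∈ segment ℝ a b) :
    orient a b x = 0 := by
  obtain ⟨s, t, -, -, h, rfl⟩ := hx
  rw [orient_combo _ _ _ _ h]
  simp only [orient]
  ring

theorem disjoint_segment_of_same_side {a b c d : Plane}
    (h : 0 < orient a b c * orient a b d) : Disjoint (segment ℝ a b) (segment ℝ c d) := by
  rw [Set.disjoint_left]
  intro x hx hy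
  have h0 := orient_eq_zero_of_mem_segment hx
  obtain ⟨s, t, hs, ht, hst, rfl⟩ := hy
  rw [orient_combo _ _ _ _ hst] at h0
  rcases pos_and_pos_or_neg_and_neg_of_mul_pos h with ⟨h1, h2⟩ | ⟨h1, h2⟩
  · rcases hs.eq_or_lt with rfl | hs
    · obtain rfl : t = 1 := by linarith
      linarith
    · nlinarith [mul_pos hs h1, mul_nonneg ht h2.le]
  · rcases hs.eq_or_lt with rfl | hs
    · obtain rfl : t = 1 := by linarith
      linarith
    · nlinarith [mul_neg_of_pos_of_neg hs h1, mul_nonpos_of_nonneg_of_nonpos ht h2.le]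

theorem eq_of_mem_segment_of_hinge {a b d x : Plane} (h : orient a b d ≠ 0)
    (hx : x ∈ segment ℝ a b) (hy : x ∈ segment ℝ a d) : x = a := by
  have h0 := orient_eq_zero_of_mem_segment hx
  obtain ⟨s, t, hs, ht, hst, rfl⟩ := hy
  rw [orient_combo _ _ _ _ hst] at h0
  have h1 : orient a b a = 0 := by simp only [orient]; ring
  rw [h1, mul_zero, zero_add] at h0
  obtain rfl : t = 0 := (mul_eq_zero.1 h0).resolve_right h
  obtain rfl : s = 1 := by linarith
  simp

/-- The affine coordinate system with origin `a` and unit points `b` and `c`. -/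
noncomputable def affineCoord (a b c : Plane) (h : orient a b c ≠ 0) : Plane ≃ₜ Plane where
  toFun p := a + p.1 • (b - a) + p.2 • (c - a)
  invFun y := (orient a y c / orient a b c, orient a b y / orient a b c)
  left_inv p := by
    ext
    · change orient a _ c / orient a b c = p.1
      rw [div_eq_iff h]
      simp only [orient, Prod.fst_add, Prod.snd_add, Prod.smul_fst, Prod.smul_snd, smul_eq_mul,
        Prod.fst_sub, Prod.snd_sub]
      ring
    · change orient a b _ / orient a b c = p.2
      rw [div_eq_iff h]
      simp only [orient, Prod.fst_add, Prod.snd_add, Prod.smul_fst, Prod.smul_snd, smul_eq_mul,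
        Prod.fst_sub, Prod.snd_sub]
      ring
  right_inv y := by
    ext <;> simp only [Prod.fst_add, Prod.snd_add, Prod.smul_fst, Prod.smul_snd, smul_eq_mul,
        Prod.fst_sub, Prod.snd_sub] <;> field_simp <;> simp only [orient] <;> ring
  continuous_toFun := by fun_prop
  continuous_invFun := by simp only [orient]; fun_prop

theorem affineCoord_apply {a b c : Plane} (h : orient a b c ≠ 0) (p : Plane) :
    affineCoord a b c h p = a + p.1 • (b - a) + p.2 • (c - a) := rfl

/-- A map of the plane that preserves affine combinations. -/
def PreservesCombos (f : Plane → Plane) : Prop :=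
  ∀ (x y : Plane) (s t : ℝ), s + t = 1 → f (s • x + t • y) = s • f x + t • f y

theorem exists_affine_homeomorph {a b c p q r : Plane} (h : orient a b c ≠ 0)
    (h' : orient p q r ≠ 0) :
    ∃ f : Plane ≃ₜ Plane, PreservesCombos f ∧
      (∀ x y z, orient x y z ≠ 0 → orient (f x) (f y) (f z) ≠ 0) ∧
      f a = p ∧ f b = q ∧ f c = r := by
  have key : ∀ x, ((affineCoord a b c h).symm.trans (affineCoord p q r h')) x =
      p + (orient a x c / orient a b c) • (q - p) + (orient a b x / orient a b c) • (r - p) :=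
    fun x => rfl
  refine ⟨(affineCoord a b c h).symm.trans (affineCoord p q r h'), ?_, ?_, ?_, ?_, ?_⟩
  · intro x y s t hst
    obtain rfl : s = 1 - t := by linarith
    simp only [key]
    ext <;> simp only [orient, Prod.fst_add, Prod.snd_add, Prod.smul_fst, Prod.smul_snd,
      smul_eq_mul, Prod.fst_sub, Prod.snd_sub] <;> ring
  · intro x y z hxyz
    -- The map multiplies signed areas by `orient p q r / orient a b c`; this identity expresses the
    -- area of xyz in the coordinates given by abc.
    have hnum : (orient a y c - orient a x c) * (orient a b z - orient a b x) -
        (orient a b y - orient a b x) * (orient a z c - orient a x c) =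
        orient a b c * orient x y z := by
      simp only [orient]
      ring
    have hcoord : ∀ s₁ t₁ s₂ t₂ s₃ t₃ : ℝ, orient (p + s₁ • (q - p) + t₁ • (r - p))
        (p + s₂ • (q - p) + t₂ • (r - p)) (p + s₃ • (q - p) + t₃ • (r - p)) =
        orient p q r * ((s₂ - s₁) * (t₃ - t₁) - (t₂ - t₁) * (s₃ - s₁)) := by
      intro s₁ t₁ s₂ t₂ s₃ t₃
      simp only [orient, Prod.fst_add, Prod.snd_add, Prod.smul_fst, Prod.smul_snd,
        smul_eq_mul, Prod.fst_sub, Prod.snd_sub]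
      ring
    rw [key, key, key, hcoord, ← sub_div, ← sub_div, ← sub_div, ← sub_div, div_mul_div_comm,
      div_mul_div_comm, ← sub_div, hnum]
    exact mul_ne_zero h' (div_ne_zero (mul_ne_zero h hxyz) (mul_ne_zero h h))
  · have h1 : orient a a c = 0 := by simp only [orient]; ring
    have h2 : orient a b a = 0 := by simp only [orient]; ring
    simp [key, h1, h2]
  · have h2 : orient a b b = 0 := by simp only [orient]; ring
    simp [key, h, h2]
  · have h1 : orient a c c = 0 := by simp only [orient]; ring
    simp [key, h, h1]

theorem PreservesCombos.image_segment {f : Plane → Plane} (hf : PreservesCombos f) (a b : Plane) :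
    f '' segment ℝ a b = segment ℝ (f a) (f b) := by
  ext x
  constructor
  · rintro ⟨_, ⟨s, t, hs, ht, hst, rfl⟩, rfl⟩
    exact ⟨s, t, hs, ht, hst, (hf _ _ _ _ hst).symm⟩
  · rintro ⟨s, t, hs, ht, hst, rfl⟩
    exact ⟨_, ⟨s, t, hs, ht, hst, rfl⟩, hf _ _ _ _ hst⟩

/-- The interior of the triangle `abc`. -/
def openTriangle (a b c : Plane) : Set Plane :=
  {x | ∃ α β γ : ℝ, 0 < α ∧ 0 < β ∧ 0 < γ ∧ α + β + γ = 1 ∧ α • a + β • b + γ • c = x}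

theorem PreservesCombos.image_openTriangle {f : Plane → Plane} (hf : PreservesCombos f)
    (a b c : Plane) : f '' openTriangle a b c = openTriangle (f a) (f b) (f c) := by
  -- A combination of three points is a binary combination of c with a point of the segment ab.
  have key : ∀ α β γ : ℝ, 0 < α → 0 < β → α + β + γ = 1 →
      f (α • a + β • b + γ • c) = α • f a + β • f b + γ • f c := by
    intro α β γ hα hβ h
    have hs : 0 < α + β := by positivity
    have h1 : ∀ u v : Plane, α • u + β • v =
        (α + β) • ((α / (α + β)) • u + (β / (α + β)) • v) := by
      intro u v
      rw [smul_add, smul_smul, smul_smul, mul_div_cancel₀ _ hs.ne', mul_div_cancel₀ _ hs.ne']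
    rw [h1, hf _ _ _ _ h, hf _ _ _ _ (by field_simp), ← h1]
  ext x
  constructor
  · rintro ⟨_, ⟨α, β, γ, hα, hβ, hγ, h, rfl⟩, rfl⟩
    exact ⟨α, β, γ, hα, hβ, hγ, h, (key _ _ _ hα hβ h).symm⟩
  · rintro ⟨α, β, γ, hα, hβ, hγ, h, rfl⟩
    exact ⟨_, ⟨α, β, γ, hα, hβ, hγ, h, rfl⟩, key _ _ _ hα hβ h⟩

theorem convex_openTriangle (a b c : Plane) : Convex ℝ (openTriangle a b c) := by
  rintro _ ⟨α, β, γ, hα, hβ, hγ, h, rfl⟩ _ ⟨α', β', γ', hα', hβ', hγ', h', rfl⟩ s t hs ht hst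
  have pos : ∀ u v : ℝ, 0 < u → 0 < v → 0 < s * u + t * v := by
    intro u v hu hv
    rcases hs.eq_or_lt with rfl | hs
    · obtain rfl : t = 1 := by linarith
      linarith
    · have := mul_nonneg ht hv.le
      have := mul_pos hs hu
      linarith
  refine ⟨s * α + t * α', s * β + t * β', s * γ + t * γ', pos _ _ hα hα', pos _ _ hβ hβ',
    pos _ _ hγ hγ', ?_, ?_⟩
  · linear_combination s * h + t * h' + hst
  · module

theorem openTriangle_nonempty (a b c : Plane) : (openTriangle a b c).Nonempty :=
  ⟨_, 1 / 3, 1 / 3, 1 / 3, by norm_num, by norm_num, by norm_num, by norm_num, rfl⟩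

theorem orient_triangle_combo (p q a b c : Plane) {α β γ : ℝ} (h : α + β + γ = 1) :
    orient p q (α • a + β • b + γ • c) =
      α * orient p q a + β * orient p q b + γ * orient p q c := by
  obtain rfl : γ = 1 - α - β := by linarith
  simp only [orient, Prod.fst_add, Prod.snd_add, Prod.smul_fst, Prod.smul_snd, smul_eq_mul]
  ring

/-- The barycentric coordinates of x are the ratios of its three areas to the area of abc. -/
theorem mem_openTriangle {a b c x : Plane} (h1 : 0 < orient a b x) (h2 : 0 < orient b c x)
    (h3 : 0 < orient c a x) : x ∈ openTriangle a b c := by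
  have hs : orient b c x + orient c a x + orient a b x = orient a b c := by
    simp only [orient]; ring
  have h0 : 0 < orient a b c := by linarith
  refine ⟨orient b c x / orient a b c, orient c a x / orient a b c, orient a b x / orient a b c,
    by positivity, by positivity, by positivity, ?_, ?_⟩
  · field_simp; linarith
  · have h0' := h0.ne'
    ext <;> simp only [Prod.fst_add, Prod.snd_add, Prod.smul_fst, Prod.smul_snd, smul_eq_mul] <;>
      field_simp <;> simp only [orient] <;> ring

theorem orient_pos_of_mem_openTriangle {a b c x : Plane} (h : 0 < orient a b c)
    (hx : x ∈ openTriangle a b c) : 0 < orient a b x := by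
  obtain ⟨α, β, γ, hα, hβ, hγ, h1, rfl⟩ := hx
  have ha : orient a b a = 0 := by simp only [orient]; ring
  have hb : orient a b b = 0 := by simp only [orient]; ring
  rw [orient_triangle_combo _ _ _ _ _ h1, ha, hb]
  have := mul_pos hγ h
  linarith

/-- The base of a triangle lies in the closure of its interior. -/
theorem segment_subset_closure_openTriangle (a b c : Plane) :
    segment ℝ a b ⊆ closure (openTriangle a b c) := by
  rintro _ ⟨s, t, hs, ht, hst, rfl⟩
  -- The approximating points move from the given point towards the interior point a/4 + b/4 + c/2,
  -- with weight 2ε.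
  have key : Filter.Tendsto (fun ε : ℝ => (s * (1 - 2 * ε) + ε / 2) • a +
      (t * (1 - 2 * ε) + ε / 2) • b + ε • c) (𝓝[>] 0) (𝓝 (s • a + t • b)) := by
    have : ContinuousAt (fun ε : ℝ => (s * (1 - 2 * ε) + ε / 2) • a +
      (t * (1 - 2 * ε) + ε / 2) • b + ε • c) 0 := by fun_prop
    have h := this.tendsto
    simp only [mul_zero, sub_zero, mul_one, zero_div, add_zero, zero_smul] at h
    exact h.mono_left nhdsWithin_le_nhds
  refine mem_closure_of_tendsto key ?_
  have hlt : ∀ᶠ ε : ℝ in 𝓝[>] 0, ε < 1 / 2 :=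
    nhdsWithin_le_nhds (Iio_mem_nhds (by norm_num))
  filter_upwards [self_mem_nhdsWithin, hlt] with ε h0 h1
  have h0 : 0 < ε := h0
  have h2 : 0 ≤ 1 - 2 * ε := by linarith
  refine ⟨_, _, _, ?_, ?_, h0, ?_, rfl⟩
  · have := mul_nonneg hs h2; linarith
  · have := mul_nonneg ht h2; linarith
  · linear_combination (1 - 2 * ε) * hst

/-- A segment and an open triangle on different sides of the line `pq` are disjoint. -/
theorem disjoint_openTriangle_segment {p q a b c d e : Plane}
    (ha : 0 ≤ orient p q a) (hb : 0 ≤ orient p q b) (hc : 0 ≤ orient p q c)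
    (hpos : 0 < orient p q a + orient p q b + orient p q c)
    (hd : orient p q d ≤ 0) (he : orient p q e ≤ 0) :
    Disjoint (openTriangle a b c) (segment ℝ d e) := by
  rw [Set.disjoint_left]
  rintro _ ⟨α, β, γ, hα, hβ, hγ, h, rfl⟩ ⟨s, t, hs, ht, hst, hx⟩
  have h1 := orient_triangle_combo p q a b c h
  have h2 := orient_combo p q d e hst
  rw [hx, h1] at h2
  have h3 : 0 < α * orient p q a + β * orient p q b + γ * orient p q c := by
    have e1 := mul_nonneg hα.le ha
    have e2 := mul_nonneg hβ.le hb
    have e3 := mul_nonneg hγ.le hc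
    rcases ha.eq_or_lt with h | h
    · rcases hb.eq_or_lt with h' | h'
      · have := mul_pos hγ (show 0 < orient p q c by linarith)
        linarith
      · have := mul_pos hβ h'
        linarith
    · have := mul_pos hα h
      linarith
  have := mul_nonpos_of_nonneg_of_nonpos hs hd
  have := mul_nonpos_of_nonneg_of_nonpos ht he
  linarith

/-- A segment with one end in the open triangle `abc` and the other end in the open triangle or at
`a` or `b` has all its points in the open triangle, except possibly for `a` and `b`. -/
theorem mem_openTriangle_of_mem_segment {a b c p q x : Plane} (hp : p ∈ openTriangle a b c)
    (hq : q ∈ openTriangle a b c ∨ q = a ∨ q = b) (hx : x ∈ segment ℝ p q) :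
    x ∈ openTriangle a b c ∨ x = a ∨ x = b := by
  rcases hq with hq | hq
  · exact Or.inl ((convex_openTriangle a b c).segment_subset hp hq hx)
  obtain ⟨s, t, hs, ht, hst, rfl⟩ := hx
  rcases hs.eq_or_lt with rfl | hs
  · obtain rfl : t = 1 := by linarith
    simpa using Or.inr hq
  left
  obtain ⟨α, β, γ, hα, hβ, hγ, h, rfl⟩ := hp
  have p1 := mul_pos hs hα
  have p2 := mul_pos hs hβ
  have p3 := mul_pos hs hγ
  rcases hq with rfl | rfl
  · exact ⟨s * α + t, s * β, s * γ, by linarith, p2, p3, by linear_combination s * h + hst,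
      by module⟩
  · exact ⟨s * α, s * β + t, s * γ, p1, by linarith, p3, by linear_combination s * h + hst,
      by module⟩

/-- This places the slot of a tile, which has a corner at vertex 1, inside the big triangle of the
tile. -/
theorem openTriangle_subset {a b c p q : Plane} (hp : p ∈ openTriangle a b c)
    (hq : q ∈ openTriangle a b c) : openTriangle b p q ⊆ openTriangle a b c := by
  rintro _ ⟨α, β, γ, hα, hβ, hγ, h, rfl⟩
  obtain ⟨x, y, z, hx, hy, hz, h1, rfl⟩ := hp
  obtain ⟨x', y', z', hx', hy', hz', h2, rfl⟩ := hq
  exact ⟨β * x + γ * x', α + β * y + γ * y', β * z + γ * z', by positivity, by positivity,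
    by positivity, by linear_combination h + β * h1 + γ * h2, by module⟩

/-! ### Simple arcs -/

theorem isArc_segment {a b : Plane} (h : a ≠ b) : IsArc a b (segment ℝ a b) := by
  refine ⟨⟨⟨fun t => AffineMap.lineMap a b (t : ℝ), by fun_prop⟩, by simp, by simp⟩, ?_, ?_⟩
  · intro s t hst
    exact Subtype.ext (AffineMap.lineMap_injective ℝ h hst)
  · rw [segment_eq_image_lineMap, Set.image_eq_range]
    rfl

theorem IsArc.symm {a b : Plane} {S : Set Plane} (h : IsArc a b S) : IsArc b a S := by
  obtain ⟨γ, hγ, rfl⟩ := h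
  refine ⟨γ.symm, ?_, γ.symm_range⟩
  intro s t hst
  exact unitInterval.symm_bijective.injective (hγ hst)

theorem IsArc.image {a b : Plane} {S : Set Plane} (h : IsArc a b S) (f : Plane ≃ₜ Plane) :
    IsArc (f a) (f b) (f '' S) := by
  obtain ⟨γ, hγ, rfl⟩ := h
  refine ⟨γ.map f.continuous, f.injective.comp hγ, ?_⟩
  rw [← Set.range_comp]
  rfl

theorem IsArc.union {a b c : Plane} {S T : Set Plane} (hS : IsArc a b S) (hT : IsArc b c T)
    (h : S ∩ T ⊆ {b}) : IsArc a c (S ∪ T) := by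
  obtain ⟨γ, hγ, rfl⟩ := hS
  obtain ⟨δ, hδ, rfl⟩ := hT
  refine ⟨γ.trans δ, ?_, γ.trans_range δ⟩
  -- The two halves of the concatenated path can agree only at the junction b.
  have mixed : ∀ x y : unitInterval, γ x = δ y → x = 1 ∧ y = 0 := by
    intro x y hxy
    have hb : γ x = b := h ⟨⟨x, rfl⟩, ⟨y, hxy.symm⟩⟩
    exact ⟨hγ (by rw [hb, γ.target]), hδ (by rw [← hxy, hb, δ.source])⟩
  intro s t hst
  rw [Path.trans_apply, Path.trans_apply] at hst
  ext
  split_ifs at hst with h1 h2 h2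
  · have := congrArg Subtype.val (hγ hst)
    dsimp at this
    linarith
  · obtain ⟨e1, e2⟩ := mixed _ _ hst
    have e1 := congrArg Subtype.val e1
    have e2 := congrArg Subtype.val e2
    dsimp at e1 e2
    linarith
  · obtain ⟨e1, e2⟩ := mixed _ _ hst.symm
    have e1 := congrArg Subtype.val e1
    have e2 := congrArg Subtype.val e2
    dsimp at e1 e2
    linarith
  · have := congrArg Subtype.val (hδ hst)
    dsimp at this
    linarith

/-! ### Crossings -/

/-- Transversality is local, so a crossing of two straight pieces is a crossing of the bent edges
that contain them. -/
theorem CrossTransversally.congr {S T S' T' : Set Plane} {x : Plane}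
    (h : CrossTransversally S T x) {U : Set Plane} (hU : IsOpen U) (hx : x ∈ U)
    (hS : ∀ y ∈ U, y ∈ S' ↔ y ∈ S) (hT : ∀ y ∈ U, y ∈ T' ↔ y ∈ T) :
    CrossTransversally S' T' x := by
  obtain ⟨φ, hφ, h0, H⟩ := h
  refine ⟨φ.restrOpen U hU, ⟨hφ, hx⟩, h0, fun y hy => ?_⟩
  rw [hS y hy.2, hT y hy.2]
  exact H y hy.1

theorem CrossTransversally.image {S T : Set Plane} {x : Plane} (h : CrossTransversally S T x)
    (f : Plane ≃ₜ Plane) : CrossTransversally (f '' S) (f '' T) (f x) := by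
  obtain ⟨φ, hφ, h0, H⟩ := h
  refine ⟨f.symm.toOpenPartialHomeomorph.trans φ, by simpa using hφ, by simpa using h0, ?_⟩
  intro y hy
  have hy' : f.symm y ∈ φ.source := by simpa using hy
  have hm : ∀ S : Set Plane, y ∈ f '' S ↔ f.symm y ∈ S := by
    intro S
    constructor
    · rintro ⟨z, hz, rfl⟩
      simpa using hz
    · intro hz
      exact ⟨_, hz, by simp⟩
  rw [hm, hm]
  exact H _ hy'

theorem ne_zero_of_crossing {a b c d : Plane} (h1 : orient a b c * orient a b d < 0) :
    orient a b d - orient a b c ≠ 0 := by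
  intro h
  have : orient a b d = orient a b c := by linarith
  rw [this] at h1
  nlinarith [mul_self_nonneg (orient a b c)]

/-- Along cd, the area over ab is an affine function with different values at the ends, so it
vanishes only once. -/
theorem eq_of_mem_crossing {a b c d x y : Plane} (h1 : orient a b c * orient a b d < 0)
    (hx : x ∈ segment ℝ a b) (hx' : x ∈ segment ℝ c d) (hy : y ∈ segment ℝ a b)
    (hy' : y ∈ segment ℝ c d) : x = y := by
  have ex := orient_eq_zero_of_mem_segment hx
  have ey := orient_eq_zero_of_mem_segment hy
  obtain ⟨s, t, -, -, hst, rfl⟩ := hx'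
  obtain ⟨s', t', -, -, hst', rfl⟩ := hy'
  rw [orient_combo _ _ _ _ hst] at ex
  rw [orient_combo _ _ _ _ hst'] at ey
  obtain rfl : s = 1 - t := by linarith
  obtain rfl : s' = 1 - t' := by linarith
  have : (t - t') * (orient a b d - orient a b c) = 0 := by linear_combination ex - ey
  obtain h := (mul_eq_zero.1 this).resolve_right (ne_zero_of_crossing h1)
  obtain rfl : t = t' := by linarith
  rfl

/-- The crossing point of two properly crossing segments lies in the interior of each. -/
theorem exists_param_of_crossing {a b c d x : Plane} (h1 : orient a b c * orient a b d < 0)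
    (hx : x ∈ segment ℝ a b) (hx' : x ∈ segment ℝ c d) :
    ∃ σ : ℝ, 0 < σ ∧ σ < 1 ∧ x = c + σ • (d - c) := by
  have ex := orient_eq_zero_of_mem_segment hx
  obtain ⟨s, t, hs, ht, hst, rfl⟩ := hx'
  rw [orient_combo _ _ _ _ hst] at ex
  obtain rfl : s = 1 - t := by linarith
  refine ⟨t, lt_of_le_of_ne ht ?_, lt_of_le_of_ne (by linarith) ?_, by module⟩
  · rintro rfl
    have : orient a b c = 0 := by linarith
    simp [this] at h1
  · rintro rfl
    have : orient a b d = 0 := by linarith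
    simp [this] at h1

theorem crossTransversally_segment {a b c d x : Plane} (h1 : orient a b c * orient a b d < 0)
    (h2 : orient c d a * orient c d b < 0) (hx : x ∈ segment ℝ a b) (hx' : x ∈ segment ℝ c d) :
    CrossTransversally (segment ℝ a b) (segment ℝ c d) x := by
  obtain ⟨σ, hσ0, hσ1, hσ⟩ := exists_param_of_crossing h1 hx hx'
  obtain ⟨τ, hτ0, hτ1, hτ⟩ := exists_param_of_crossing h2 hx' hx
  have hne : orient x (x + (b - a)) (x + (d - c)) ≠ 0 := by
    have : orient x (x + (b - a)) (x + (d - c)) = orient a b d - orient a b c := by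
      simp only [orient, Prod.fst_add, Prod.snd_add, Prod.fst_sub, Prod.snd_sub]
      ring
    rw [this]
    exact ne_zero_of_crossing h1
  set K := affineCoord x (x + (b - a)) (x + (d - c)) hne with hK
  have K_apply : ∀ s t : ℝ, K (s, t) = x + s • (b - a) + t • (d - c) := by
    intro s t
    rw [hK, affineCoord_apply]
    simp
  -- In coordinates with origin x and axes along the two segments, ab occupies [-τ, 1 - τ] on the
  -- first axis and cd occupies [-σ, 1 - σ] on the second. In this open box they therefore agree
  -- with the full axes.
  let W : Set Plane := Ioo (-τ) (1 - τ) ×ˢ Ioo (-σ) (1 - σ)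
  have hW : IsOpen W := isOpen_Ioo.prod isOpen_Ioo
  have hU : IsOpen (K.symm ⁻¹' W) := hW.preimage K.symm.continuous
  have hx0 : K.symm x = 0 := by
    rw [Homeomorph.symm_apply_eq]
    exact ((K_apply 0 0).trans (by simp)).symm
  refine ⟨K.symm.toOpenPartialHomeomorph.restrOpen _ hU, ?_, hx0, ?_⟩
  · refine ⟨mem_univ _, ?_⟩
    rw [mem_preimage, hx0]
    exact ⟨⟨by simpa using hτ0, by simpa using hτ1⟩, ⟨by simpa using hσ0, by simpa using hσ1⟩⟩
  rintro y ⟨-, hy⟩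
  obtain ⟨⟨s, t⟩, rfl⟩ := K.surjective y
  rw [mem_preimage, Homeomorph.symm_apply_apply] at hy
  obtain ⟨⟨hs1, hs2⟩, ⟨ht1, ht2⟩⟩ := hy
  dsimp only at hs1 hs2 ht1 ht2
  change (_ ↔ (K.symm (K (s, t))).2 = 0) ∧ (_ ↔ (K.symm (K (s, t))).1 = 0)
  rw [Homeomorph.symm_apply_apply]
  constructor
  · constructor
    · rintro ⟨m, ρ, -, -, hm, hρ⟩
      obtain rfl : m = 1 - ρ := by linarith
      have : K (s, t) = K (ρ - τ, 0) := by
        rw [← hρ, K_apply, hτ]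
        module
      exact congrArg Prod.snd (K.injective this)
    · rintro (rfl : t = 0)
      refine ⟨1 - (s + τ), s + τ, by linarith, by linarith, by ring, ?_⟩
      rw [K_apply, hτ]
      module
  · constructor
    · rintro ⟨m, ρ, -, -, hm, hρ⟩
      obtain rfl : m = 1 - ρ := by linarith
      have : K (s, t) = K (0, ρ - σ) := by
        rw [← hρ, K_apply, hσ]
        module
      exact congrArg Prod.fst (K.injective this)
    · rintro (rfl : s = 0)
      refine ⟨1 - (t + σ), t + σ, by linarith, by linarith, by ring, ?_⟩
      rw [K_apply, hσ]
      module

/-! ### Images of drawings under homeomorphisms of the plane -/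

namespace Drawing

variable {V : Type} {G : SimpleGraph V}

/-- The image of a drawing under a homeomorphism of the plane. -/
def mapHomeo (D : Drawing G) (f : Plane ≃ₜ Plane) : Drawing G where
  point v := f (D.point v)
  arc e := f '' D.arc e
  point_injective := f.injective.comp D.point_injective
  isArc u v h := (D.isArc u v h).image f
  mem_of_point_mem e he w hw := D.mem_of_point_mem e he w (by simpa using hw)

theorem crossAt_mapHomeo {D : Drawing G} {f : Plane ≃ₜ Plane} {e e' : Sym2 V} {x : Plane}
    (h : (D.mapHomeo f).CrossAt e e' x) : ∃ y, D.CrossAt e e' y ∧ f y = x := by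
  obtain ⟨h1, h2, h3, ⟨y, hy, rfl⟩, ⟨z, hz, hzy⟩, h6⟩ := h
  obtain rfl := f.injective hzy
  refine ⟨z, ⟨h1, h2, h3, hy, hz, ?_⟩, rfl⟩
  rintro ⟨w, rfl⟩
  exact h6 ⟨w, rfl⟩

theorem NonCrossing.mapHomeo {D : Drawing G} {e : Sym2 V} (h : D.NonCrossing e)
    (f : Plane ≃ₜ Plane) : (D.mapHomeo f).NonCrossing e :=
  ⟨h.1, fun e' _ hx => let ⟨y, hy, _⟩ := crossAt_mapHomeo hx; h.2 e' y hy⟩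

theorem IsOnePlanar.mapHomeo {D : Drawing G} (h : D.IsOnePlanar) (f : Plane ≃ₜ Plane) :
    (D.mapHomeo f).IsOnePlanar := by
  intro e e₁ e₂ x y hx hy
  obtain ⟨x, cx, rfl⟩ := crossAt_mapHomeo hx
  obtain ⟨y, cy, rfl⟩ := crossAt_mapHomeo hy
  obtain ⟨h1, h2⟩ := h _ _ _ _ _ cx cy
  exact ⟨h1, congrArg f h2⟩

theorem image_mapHomeo (D : Drawing G) (f : Plane ≃ₜ Plane) :
    (D.mapHomeo f).image = f '' D.image := by
  rw [image, image, image_union, image_iUnion₂, ← range_comp]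
  rfl

theorem arc_subset_image (D : Drawing G) {e : Sym2 V} (he : e ∈ G.edgeSet) : D.arc e ⊆ D.image :=
  fun _ hx => Or.inr (mem_iUnion₂.2 ⟨e, he, hx⟩)

theorem point_mem_image (D : Drawing G) (v : V) : D.point v ∈ D.image := Or.inl ⟨v, rfl⟩

/-- Uniqueness of the crossing point and the absence of triple crossings are special cases of
1-planarity. -/
theorem isGood_of_isOnePlanar {D : Drawing G} (h : D.IsOnePlanar)
    (h1 : ∀ e f : Sym2 V, ∀ w : V, w ∈ e → w ∈ f → ∀ x, ¬ D.CrossAt e f x)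
    (h2 : ∀ e f : Sym2 V, ∀ x, D.CrossAt e f x → CrossTransversally (D.arc e) (D.arc f) x) :
    D.IsGood where
  not_cross_of_incident := h1
  cross_at_most_once e f x y hx hy := (h e f f x y hx hy).2
  transversal := h2
  no_triple e f g x hx hy := (h e f g x x hx hy).1

/-- A connected set in the complement of a drawing lies in a face; the arcs in its closure are on
the boundary of that face. -/
theorem exists_face (D : Drawing G) {T : Set Plane} (hT : IsPreconnected T)
    (hdisj : Disjoint T D.image) (hne : T.Nonempty) :
    ∃ F, D.IsFace F ∧ T ⊆ F ∧ ∀ e ∈ G.edgeSet, D.arc e ⊆ closure T → D.arc e ⊆ frontier F := by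
  obtain ⟨x, hx⟩ := hne
  have hTc : T ⊆ D.imageᶜ := fun y hy hy' => Set.disjoint_left.1 hdisj hy hy'
  have hTF := hT.subset_connectedComponentIn hx hTc
  refine ⟨_, ⟨x, hTc hx, rfl⟩, hTF, fun e he hcl y hy => ⟨closure_mono hTF (hcl hy), fun hy' => ?_⟩⟩
  exact connectedComponentIn_subset _ _ (interior_subset hy') (D.arc_subset_image he hy)

end Drawing

namespace OnePlaneGraph

/-- The image of a 1-plane graph under a homeomorphism of the plane. -/
def mapHomeo {V : Type} (G : OnePlaneGraph V) (f : Plane ≃ₜ Plane) : OnePlaneGraph V where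
  finite := G.finite
  graph := G.graph
  drawing := G.drawing.mapHomeo f
  onePlanar := G.onePlanar.mapHomeo f
  good := by
    refine Drawing.isGood_of_isOnePlanar (G.onePlanar.mapHomeo f) ?_ ?_
    · intro e e' w hw hw' x hx
      obtain ⟨x, cx, rfl⟩ := Drawing.crossAt_mapHomeo hx
      exact G.good.not_cross_of_incident e e' w hw hw' x cx
    · intro e e' x hx
      obtain ⟨x, cx, rfl⟩ := Drawing.crossAt_mapHomeo hx
      exact (G.good.transversal e e' x cx).image f

/-! ### Merging two drawings -/

/-- The data needed to merge `G₁` and `G₂` along `u₁v₁` and `u₂v₂`: the rest of `G₂` lies in a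
connected set `T` that avoids `G₁`, and the merged edge can be reached from `T` and from an
unbounded connected set `U` that avoids `G₂`. -/
structure MergeData {V₁ V₂ V : Type} (G₁ : OnePlaneGraph V₁) (G₂ : OnePlaneGraph V₂)
    (f₁ : V₁ ↪ V) (f₂ : V₂ ↪ V) (u₁ v₁ : V₁) (u₂ v₂ : V₂) (T U : Set Plane) : Prop where
  nonCrossing₁ : G₁.drawing.NonCrossing s(u₁, v₁)
  nonCrossing₂ : G₂.drawing.NonCrossing s(u₂, v₂)
  map_u : f₁ u₁ = f₂ u₂
  map_v : f₁ v₁ = f₂ v₂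
  range_union : range f₁ ∪ range f₂ = univ
  range_inter : range f₁ ∩ range f₂ = {f₁ u₁, f₁ v₁}
  point_u : G₂.drawing.point u₂ = G₁.drawing.point u₁
  point_v : G₂.drawing.point v₂ = G₁.drawing.point v₁
  arc_eq : G₂.drawing.arc s(u₂, v₂) = G₁.drawing.arc s(u₁, v₁)
  preconnected₁ : IsPreconnected T
  nonempty₁ : T.Nonempty
  disjoint₁ : Disjoint T G₁.drawing.image
  arc_subset₁ : G₁.drawing.arc s(u₁, v₁) ⊆ closure T
  subset : G₂.drawing.image \ G₂.drawing.arc s(u₂, v₂) ⊆ T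
  preconnected₂ : IsPreconnected U
  not_isBounded : ¬ Bornology.IsBounded U
  disjoint₂ : Disjoint U G₂.drawing.image
  arc_subset₂ : G₂.drawing.arc s(u₂, v₂) ⊆ closure U

namespace MergeData

variable {V₁ V₂ V : Type} {G₁ : OnePlaneGraph V₁} {G₂ : OnePlaneGraph V₂}
  {f₁ : V₁ ↪ V} {f₂ : V₂ ↪ V} {u₁ v₁ : V₁} {u₂ v₂ : V₂} {T U : Set Plane}

theorem eq_or_eq (M : MergeData G₁ G₂ f₁ f₂ u₁ v₁ u₂ v₂ T U) {a : V₁} {b : V₂}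
    (h : f₁ a = f₂ b) : (a = u₁ ∧ b = u₂) ∨ (a = v₁ ∧ b = v₂) := by
  have : f₁ a ∈ range f₁ ∩ range f₂ := ⟨⟨a, rfl⟩, ⟨b, h.symm⟩⟩
  rw [M.range_inter] at this
  rcases this with h' | h'
  · exact Or.inl ⟨f₁.injective h', f₂.injective (by rw [← h, h', M.map_u])⟩
  · exact Or.inr ⟨f₁.injective h', f₂.injective (by rw [← h, h', M.map_v])⟩

/-- The two graphs share only two vertices, and the ends of an edge are distinct, so a shared edge
has exactly these ends. -/
theorem edge_eq (M : MergeData G₁ G₂ f₁ f₂ u₁ v₁ u₂ v₂ T U) {e₁ : Sym2 V₁} {e₂ : Sym2 V₂}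
    (h₂ : e₂ ∈ G₂.graph.edgeSet) (h : e₁.map f₁ = e₂.map f₂) :
    e₁ = s(u₁, v₁) ∧ e₂ = s(u₂, v₂) := by
  induction e₁ with | _ a a'
  induction e₂ with | _ b b'
  have hne : b ≠ b' := G₂.graph.ne_of_adj h₂
  rw [Sym2.map_mk, Sym2.map_mk, Sym2.eq_iff] at h
  rcases h with ⟨h, h'⟩ | ⟨h, h'⟩ <;>
    rcases M.eq_or_eq h with ⟨rfl, rfl⟩ | ⟨rfl, rfl⟩ <;>
    rcases M.eq_or_eq h' with ⟨rfl, rfl⟩ | ⟨rfl, rfl⟩ <;>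
    first
    | exact absurd rfl hne
    | exact ⟨rfl, rfl⟩
    | exact ⟨Sym2.eq_swap, Sym2.eq_swap⟩
    | exact ⟨Sym2.eq_swap, rfl⟩
    | exact ⟨rfl, Sym2.eq_swap⟩

/-- The two drawings meet only in the merged edge. -/
theorem mem_arc_of_mem (M : MergeData G₁ G₂ f₁ f₂ u₁ v₁ u₂ v₂ T U) {x : Plane}
    (h₁ : x ∈ G₁.drawing.image) (h₂ : x ∈ G₂.drawing.image) :
    x ∈ G₂.drawing.arc s(u₂, v₂) := by
  by_contra h
  exact Set.disjoint_left.1 M.disjoint₁ (M.subset ⟨h₂, h⟩) h₁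

/-- The position of the vertices in the merged drawing. -/
noncomputable def point (_ : MergeData G₁ G₂ f₁ f₂ u₁ v₁ u₂ v₂ T U) : V → Plane :=
  Function.extend f₁ G₁.drawing.point (Function.extend f₂ G₂.drawing.point 0)

/-- The edges of the merged drawing. -/
noncomputable def arc (_ : MergeData G₁ G₂ f₁ f₂ u₁ v₁ u₂ v₂ T U) : Sym2 V → Set Plane :=
  Function.extend (Sym2.map f₁) G₁.drawing.arc
    (Function.extend (Sym2.map f₂) G₂.drawing.arc (fun _ => ∅))

theorem point_left (M : MergeData G₁ G₂ f₁ f₂ u₁ v₁ u₂ v₂ T U) (a : V₁) :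
    M.point (f₁ a) = G₁.drawing.point a := f₁.injective.extend_apply _ _ _

theorem point_right (M : MergeData G₁ G₂ f₁ f₂ u₁ v₁ u₂ v₂ T U) (b : V₂) :
    M.point (f₂ b) = G₂.drawing.point b := by
  by_cases h : ∃ a, f₁ a = f₂ b
  · obtain ⟨a, ha⟩ := h
    rw [← ha, M.point_left]
    rcases M.eq_or_eq ha with ⟨rfl, rfl⟩ | ⟨rfl, rfl⟩
    · exact M.point_u.symm
    · exact M.point_v.symm
  · rw [point, Function.extend_apply' _ _ _ h, f₂.injective.extend_apply]

theorem arc_left (M : MergeData G₁ G₂ f₁ f₂ u₁ v₁ u₂ v₂ T U) (e : Sym2 V₁) :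
    M.arc (e.map f₁) = G₁.drawing.arc e := (Sym2.map.injective f₁.injective).extend_apply _ _ _

theorem arc_right (M : MergeData G₁ G₂ f₁ f₂ u₁ v₁ u₂ v₂ T U) {e : Sym2 V₂}
    (he : e ∈ G₂.graph.edgeSet) : M.arc (e.map f₂) = G₂.drawing.arc e := by
  by_cases h : ∃ e', Sym2.map f₁ e' = e.map f₂
  · obtain ⟨e', h⟩ := h
    rw [← h, M.arc_left]
    obtain ⟨rfl, rfl⟩ := M.edge_eq he h
    exact M.arc_eq.symm
  · rw [arc, Function.extend_apply' _ _ _ h, (Sym2.map.injective f₂.injective).extend_apply]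

theorem exists_preimage (M : MergeData G₁ G₂ f₁ f₂ u₁ v₁ u₂ v₂ T U) (x : V) :
    (∃ a, f₁ a = x) ∨ ∃ b, f₂ b = x := by
  have : x ∈ range f₁ ∪ range f₂ := M.range_union ▸ mem_univ x
  exact this

theorem eq_of_point_eq (M : MergeData G₁ G₂ f₁ f₂ u₁ v₁ u₂ v₂ T U) {a : V₁} {b : V₂}
    (h : G₁.drawing.point a = G₂.drawing.point b) : f₁ a = f₂ b := by
  have hb := M.mem_arc_of_mem (h ▸ G₁.drawing.point_mem_image a) (G₂.drawing.point_mem_image b)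
  rcases Sym2.mem_iff.1 (G₂.drawing.mem_of_point_mem _ M.nonCrossing₂.1 b hb) with rfl | rfl
  · rw [M.point_u] at h
    rw [← M.map_u, G₁.drawing.point_injective h]
  · rw [M.point_v] at h
    rw [← M.map_v, G₁.drawing.point_injective h]

theorem mem_edgeSet (e : Sym2 V) :
    e ∈ (G₁.graph.map f₁ ⊔ G₂.graph.map f₂).edgeSet ↔
      (∃ e' ∈ G₁.graph.edgeSet, e'.map f₁ = e) ∨ ∃ e' ∈ G₂.graph.edgeSet, e'.map f₂ = e := by
  rw [SimpleGraph.edgeSet_sup, SimpleGraph.edgeSet_map, SimpleGraph.edgeSet_map]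
  rfl

/-- The union of the two drawings. -/
noncomputable def drawing (M : MergeData G₁ G₂ f₁ f₂ u₁ v₁ u₂ v₂ T U) :
    Drawing (G₁.graph.map f₁ ⊔ G₂.graph.map f₂) where
  point := M.point
  arc := M.arc
  point_injective := by
    intro x y hxy
    rcases M.exists_preimage x with ⟨a, rfl⟩ | ⟨a, rfl⟩ <;>
      rcases M.exists_preimage y with ⟨b, rfl⟩ | ⟨b, rfl⟩ <;>
      simp only [M.point_left, M.point_right] at hxy
    · rw [G₁.drawing.point_injective hxy]
    · exact M.eq_of_point_eq hxy
    · exact (M.eq_of_point_eq hxy.symm).symm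
    · rw [G₂.drawing.point_injective hxy]
  isArc := by
    rintro _ _ (⟨-, a, b, h, rfl, rfl⟩ | ⟨-, a, b, h, rfl, rfl⟩)
    · have := M.arc_left s(a, b)
      rw [Sym2.map_mk] at this
      rw [this, M.point_left, M.point_left]
      exact G₁.drawing.isArc a b h
    · have := M.arc_right (e := s(a, b)) h
      rw [Sym2.map_mk] at this
      rw [this, M.point_right, M.point_right]
      exact G₂.drawing.isArc a b h
  mem_of_point_mem := by
    intro e he w hw
    rcases (mem_edgeSet e).1 he with ⟨e, he', rfl⟩ | ⟨e, he', rfl⟩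
    · rw [M.arc_left] at hw
      have key : ∃ a, f₁ a = w := by
        rcases M.exists_preimage w with h | ⟨b, rfl⟩
        · exact h
        · rw [M.point_right] at hw
          have hb := M.mem_arc_of_mem (G₁.drawing.arc_subset_image he' hw)
            (G₂.drawing.point_mem_image b)
          rcases Sym2.mem_iff.1 (G₂.drawing.mem_of_point_mem _ M.nonCrossing₂.1 b hb) with
            rfl | rfl
          · exact ⟨_, M.map_u⟩
          · exact ⟨_, M.map_v⟩
      obtain ⟨a, rfl⟩ := key
      rw [M.point_left] at hw
      exact Sym2.mem_map.2 ⟨a, G₁.drawing.mem_of_point_mem e he' a hw, rfl⟩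
    · rw [M.arc_right he'] at hw
      have key : ∃ b, f₂ b = w := by
        rcases M.exists_preimage w with ⟨a, rfl⟩ | h
        · rw [M.point_left] at hw
          have ha := M.mem_arc_of_mem (G₁.drawing.point_mem_image a)
            (G₂.drawing.arc_subset_image he' hw)
          rw [M.arc_eq] at ha
          rcases Sym2.mem_iff.1 (G₁.drawing.mem_of_point_mem _ M.nonCrossing₁.1 a ha) with
            rfl | rfl
          · exact ⟨_, M.map_u.symm⟩
          · exact ⟨_, M.map_v.symm⟩
        · exact h
      obtain ⟨b, rfl⟩ := key
      rw [M.point_right] at hw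
      exact Sym2.mem_map.2 ⟨b, G₂.drawing.mem_of_point_mem e he' b hw, rfl⟩

theorem not_mem_both (M : MergeData G₁ G₂ f₁ f₂ u₁ v₁ u₂ v₂ T U) {e : Sym2 V₁} {e' : Sym2 V₂}
    {x : Plane} (he : e ∈ G₁.graph.edgeSet) (he' : e' ∈ G₂.graph.edgeSet)
    (hne : e.map f₁ ≠ e'.map f₂) (hx : x ∈ G₁.drawing.arc e) (hx' : x ∈ G₂.drawing.arc e')
    (hp : x ∉ range M.point) : False := by
  have h2 : x ∈ G₂.drawing.arc s(u₂, v₂) :=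
    M.mem_arc_of_mem (G₁.drawing.arc_subset_image he hx) (G₂.drawing.arc_subset_image he' hx')
  -- The common point lies on the merged edge. If e' is that edge, e crosses it in the first
  -- drawing; otherwise e' crosses it in the second. Both are excluded.
  by_cases h : s(u₂, v₂) = e'
  · subst h
    have h1 : x ∈ G₁.drawing.arc s(u₁, v₁) := M.arc_eq ▸ h2
    refine M.nonCrossing₁.2 e x ⟨M.nonCrossing₁.1, he, ?_, h1, hx, ?_⟩
    · rintro rfl
      exact hne (by rw [Sym2.map_mk, Sym2.map_mk, M.map_u, M.map_v])
    · rintro ⟨a, rfl⟩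
      exact hp ⟨f₁ a, M.point_left a⟩
  · refine M.nonCrossing₂.2 e' x ⟨M.nonCrossing₂.1, he', h, h2, hx', ?_⟩
    rintro ⟨b, rfl⟩
    exact hp ⟨f₂ b, M.point_right b⟩

/-- Every crossing of the merged drawing is a crossing of one of the two drawings. -/
theorem crossAt_drawing (M : MergeData G₁ G₂ f₁ f₂ u₁ v₁ u₂ v₂ T U) {e f : Sym2 V} {x : Plane}
    (h : M.drawing.CrossAt e f x) :
    (∃ e' f', e'.map f₁ = e ∧ f'.map f₁ = f ∧ G₁.drawing.CrossAt e' f' x) ∨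
      ∃ e' f', e'.map f₂ = e ∧ f'.map f₂ = f ∧ G₂.drawing.CrossAt e' f' x := by
  obtain ⟨he, hf, hne, hxe, hxf, hp⟩ := h
  change x ∈ M.arc e at hxe
  change x ∈ M.arc f at hxf
  change x ∉ range M.point at hp
  rcases (mem_edgeSet e).1 he with ⟨e, he', rfl⟩ | ⟨e, he', rfl⟩ <;>
    rcases (mem_edgeSet f).1 hf with ⟨f, hf', rfl⟩ | ⟨f, hf', rfl⟩
  · rw [M.arc_left] at hxe hxf
    refine Or.inl ⟨e, f, rfl, rfl, he', hf', fun h => hne (by rw [h]), hxe, hxf, ?_⟩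
    rintro ⟨a, rfl⟩
    exact hp ⟨f₁ a, M.point_left a⟩
  · rw [M.arc_left] at hxe
    rw [M.arc_right hf'] at hxf
    exact (M.not_mem_both he' hf' hne hxe hxf hp).elim
  · rw [M.arc_left] at hxf
    rw [M.arc_right he'] at hxe
    exact (M.not_mem_both hf' he' hne.symm hxf hxe hp).elim
  · rw [M.arc_right he'] at hxe
    rw [M.arc_right hf'] at hxf
    refine Or.inr ⟨e, f, rfl, rfl, he', hf', fun h => hne (by rw [h]), hxe, hxf, ?_⟩
    rintro ⟨a, rfl⟩
    exact hp ⟨f₂ a, M.point_right a⟩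

/-- An edge with crossings from both drawings would be the merged edge, which has none in either. -/
theorem isOnePlanar_drawing (M : MergeData G₁ G₂ f₁ f₂ u₁ v₁ u₂ v₂ T U) :
    M.drawing.IsOnePlanar := by
  intro e f g x y hx hy
  rcases M.crossAt_drawing hx with ⟨e₁, f', rfl, rfl, cx⟩ | ⟨e₁, f', rfl, rfl, cx⟩ <;>
    rcases M.crossAt_drawing hy with ⟨e₂, g', h, rfl, cy⟩ | ⟨e₂, g', h, rfl, cy⟩
  · obtain rfl := Sym2.map.injective f₁.injective h
    obtain ⟨rfl, rfl⟩ := G₁.onePlanar _ _ _ _ _ cx cy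
    exact ⟨rfl, rfl⟩
  · obtain ⟨rfl, rfl⟩ := M.edge_eq cy.1 h.symm
    exact (M.nonCrossing₁.2 _ _ cx).elim
  · obtain ⟨rfl, rfl⟩ := M.edge_eq cx.1 h
    exact (M.nonCrossing₂.2 _ _ cx).elim
  · obtain rfl := Sym2.map.injective f₂.injective h
    obtain ⟨rfl, rfl⟩ := G₂.onePlanar _ _ _ _ _ cx cy
    exact ⟨rfl, rfl⟩

theorem isGood_drawing (M : MergeData G₁ G₂ f₁ f₂ u₁ v₁ u₂ v₂ T U) : M.drawing.IsGood := by
  refine Drawing.isGood_of_isOnePlanar M.isOnePlanar_drawing ?_ ?_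
  · intro e f w hw hw' x hx
    rcases M.crossAt_drawing hx with ⟨e, f, rfl, rfl, cx⟩ | ⟨e, f, rfl, rfl, cx⟩
    · obtain ⟨a, ha, rfl⟩ := Sym2.mem_map.1 hw
      obtain ⟨b, hb, hab⟩ := Sym2.mem_map.1 hw'
      obtain rfl := f₁.injective hab
      exact G₁.good.not_cross_of_incident e f b ha hb x cx
    · obtain ⟨a, ha, rfl⟩ := Sym2.mem_map.1 hw
      obtain ⟨b, hb, hab⟩ := Sym2.mem_map.1 hw'
      obtain rfl := f₂.injective hab
      exact G₂.good.not_cross_of_incident e f b ha hb x cx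
  · intro e f x hx
    change CrossTransversally (M.arc e) (M.arc f) x
    rcases M.crossAt_drawing hx with ⟨e, f, rfl, rfl, cx⟩ | ⟨e, f, rfl, rfl, cx⟩
    · rw [M.arc_left, M.arc_left]
      exact G₁.good.transversal e f x cx
    · rw [M.arc_right cx.1, M.arc_right cx.2.1]
      exact G₂.good.transversal e f x cx

/-- The merged 1-plane graph. -/
noncomputable def merge [Finite V] (M : MergeData G₁ G₂ f₁ f₂ u₁ v₁ u₂ v₂ T U) :
    OnePlaneGraph V where
  finite := inferInstance
  graph := G₁.graph.map f₁ ⊔ G₂.graph.map f₂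
  drawing := M.drawing
  good := M.isGood_drawing
  onePlanar := M.isOnePlanar_drawing

theorem isEdgeMerging_merge [Finite V] (M : MergeData G₁ G₂ f₁ f₂ u₁ v₁ u₂ v₂ T U) :
    IsEdgeMerging G₁ G₂ M.merge := by
  have hUne : U.Nonempty := by
    rw [Set.nonempty_iff_ne_empty]
    rintro rfl
    exact M.not_isBounded Bornology.isBounded_empty
  obtain ⟨F, hF, hTF, hF'⟩ := G₁.drawing.exists_face M.preconnected₁ M.disjoint₁ M.nonempty₁
  obtain ⟨F₂, hF₂, hUF, hF₂'⟩ := G₂.drawing.exists_face M.preconnected₂ M.disjoint₂ hUne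
  refine ⟨u₁, v₁, u₂, v₂, f₁, f₂, G₂.drawing, F₂, F, M.nonCrossing₁, M.nonCrossing₂, ?_, hF₂,
    fun h => M.not_isBounded (h.subset hUF), hF₂' _ M.nonCrossing₂.1 M.arc_subset₂, hF,
    hF' _ M.nonCrossing₁.1 M.arc_subset₁, M.arc_eq, M.subset.trans hTF, M.map_u, M.map_v,
    M.range_union, M.range_inter, rfl, M.point_left, M.point_right, fun e _ => M.arc_left e,
    fun e he => M.arc_right he⟩
  -- No redrawing is needed, because `MergeData` requires the second graph to be in its final
  -- position already.
  exact ⟨Homeomorph.refl _, fun _ => rfl, fun e _ => by simp⟩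

theorem nonCrossing_merge [Finite V] (M : MergeData G₁ G₂ f₁ f₂ u₁ v₁ u₂ v₂ T U) {e : Sym2 V₂}
    (he : G₂.drawing.NonCrossing e) : M.merge.drawing.NonCrossing (e.map f₂) := by
  refine ⟨(mem_edgeSet _).2 (Or.inr ⟨e, he.1, rfl⟩), fun f x hx => ?_⟩
  rcases M.crossAt_drawing hx with ⟨e', f, h, rfl, cx⟩ | ⟨e', f, h, rfl, cx⟩
  · obtain ⟨rfl, rfl⟩ := M.edge_eq he.1 h
    exact M.nonCrossing₁.2 _ _ cx
  · obtain rfl := Sym2.map.injective f₂.injective h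
    exact he.2 _ _ cx

theorem image_merge [Finite V] (M : MergeData G₁ G₂ f₁ f₂ u₁ v₁ u₂ v₂ T U) :
    M.merge.drawing.image ⊆ G₁.drawing.image ∪ G₂.drawing.image := by
  rintro x (⟨w, rfl⟩ | hx)
  · rcases M.exists_preimage w with ⟨a, rfl⟩ | ⟨b, rfl⟩
    · exact Or.inl ((M.point_left a).symm ▸ G₁.drawing.point_mem_image a : M.point _ ∈ _)
    · exact Or.inr ((M.point_right b).symm ▸ G₂.drawing.point_mem_image b : M.point _ ∈ _)
  · obtain ⟨e, he, hx⟩ := mem_iUnion₂.1 hx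
    change x ∈ M.arc e at hx
    rcases (mem_edgeSet e).1 he with ⟨e, he', rfl⟩ | ⟨e, he', rfl⟩
    · exact Or.inl (G₁.drawing.arc_subset_image he' (M.arc_left e ▸ hx))
    · exact Or.inr (G₂.drawing.arc_subset_image he' (M.arc_right he' ▸ hx))

/-! ### Degrees in the merged graph -/

theorem adj_merge [Finite V] (M : MergeData G₁ G₂ f₁ f₂ u₁ v₁ u₂ v₂ T U) (x y : V) :
    M.merge.graph.Adj x y ↔ (∃ a b, G₁.graph.Adj a b ∧ f₁ a = x ∧ f₁ b = y) ∨
      ∃ a b, G₂.graph.Adj a b ∧ f₂ a = x ∧ f₂ b = y := by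
  change (G₁.graph.map f₁ ⊔ G₂.graph.map f₂).Adj x y ↔ _
  rw [SimpleGraph.sup_adj, SimpleGraph.map_adj, SimpleGraph.map_adj]

theorem neighborSet_left [Finite V] (M : MergeData G₁ G₂ f₁ f₂ u₁ v₁ u₂ v₂ T U) {a : V₁}
    (hu : a ≠ u₁) (hv : a ≠ v₁) :
    M.merge.graph.neighborSet (f₁ a) = f₁ '' G₁.graph.neighborSet a := by
  ext y
  rw [SimpleGraph.mem_neighborSet, adj_merge]
  constructor
  · rintro (⟨a', b, h, h', rfl⟩ | ⟨a', b, h, h', rfl⟩)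
    · obtain rfl := f₁.injective h'
      exact ⟨b, h, rfl⟩
    · rcases M.eq_or_eq h'.symm with ⟨h, -⟩ | ⟨h, -⟩
      · exact (hu h).elim
      · exact (hv h).elim
  · rintro ⟨b, h, rfl⟩
    exact Or.inl ⟨a, b, h, rfl, rfl⟩

theorem neighborSet_right [Finite V] (M : MergeData G₁ G₂ f₁ f₂ u₁ v₁ u₂ v₂ T U) {b : V₂}
    (hu : b ≠ u₂) (hv : b ≠ v₂) :
    M.merge.graph.neighborSet (f₂ b) = f₂ '' G₂.graph.neighborSet b := by
  ext y
  rw [SimpleGraph.mem_neighborSet, adj_merge]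
  constructor
  · rintro (⟨a', b', h, h', rfl⟩ | ⟨a', b', h, h', rfl⟩)
    · rcases M.eq_or_eq h' with ⟨-, h⟩ | ⟨-, h⟩
      · exact (hu h).elim
      · exact (hv h).elim
    · obtain rfl := f₂.injective h'
      exact ⟨b', h, rfl⟩
  · rintro ⟨b', h, rfl⟩
    exact Or.inr ⟨b, b', h, rfl, rfl⟩

/-- Applied to the two neighbourhoods of an end of the merged edge, which share only the other end.
-/
theorem odd_ncard_union_iff {α : Type*} {A B : Set α} {x : α} (hA : A.Finite) (hB : B.Finite)
    (h : A ∩ B = {x}) (hB' : ¬ Odd B.ncard) : Odd (A ∪ B).ncard ↔ ¬ Odd A.ncard := by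
  have := Set.ncard_union_add_ncard_inter A B hA hB
  rw [h, Set.ncard_singleton] at this
  grind

/-- Exchanging the ends of the merged edge transfers the degree count at u to v. -/
theorem symm (M : MergeData G₁ G₂ f₁ f₂ u₁ v₁ u₂ v₂ T U) :
    MergeData G₁ G₂ f₁ f₂ v₁ u₁ v₂ u₂ T U := by
  have s1 : s(v₁, u₁) = s(u₁, v₁) := Sym2.eq_swap
  have s2 : s(v₂, u₂) = s(u₂, v₂) := Sym2.eq_swap
  constructor
  · rw [s1]; exact M.nonCrossing₁
  · rw [s2]; exact M.nonCrossing₂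
  · exact M.map_v
  · exact M.map_u
  · exact M.range_union
  · rw [M.range_inter, Set.pair_comm]
  · exact M.point_v
  · exact M.point_u
  · rw [s1, s2]; exact M.arc_eq
  · exact M.preconnected₁
  · exact M.nonempty₁
  · exact M.disjoint₁
  · rw [s1]; exact M.arc_subset₁
  · rw [s2]; exact M.subset
  · exact M.preconnected₂
  · exact M.not_isBounded
  · exact M.disjoint₂
  · rw [s2]; exact M.arc_subset₂

theorem odd_degree_u [Finite V] (M : MergeData G₁ G₂ f₁ f₂ u₁ v₁ u₂ v₂ T U)
    (h : ¬ Odd (G₂.graph.neighborSet u₂).ncard) :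
    Odd (M.merge.graph.neighborSet (f₁ u₁)).ncard ↔ ¬ Odd (G₁.graph.neighborSet u₁).ncard := by
  have hn : M.merge.graph.neighborSet (f₁ u₁) =
      f₁ '' G₁.graph.neighborSet u₁ ∪ f₂ '' G₂.graph.neighborSet u₂ := by
    ext y
    rw [SimpleGraph.mem_neighborSet, adj_merge]
    constructor
    · rintro (⟨a, b, hab, h', rfl⟩ | ⟨a, b, hab, h', rfl⟩)
      · obtain rfl := f₁.injective h'
        exact Or.inl ⟨b, hab, rfl⟩
      · rw [M.map_u] at h'
        obtain rfl := f₂.injective h'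
        exact Or.inr ⟨b, hab, rfl⟩
    · rintro (⟨b, hab, rfl⟩ | ⟨b, hab, rfl⟩)
      · exact Or.inl ⟨u₁, b, hab, rfl, rfl⟩
      · exact Or.inr ⟨u₂, b, hab, M.map_u.symm, rfl⟩
  have hi : f₁ '' G₁.graph.neighborSet u₁ ∩ f₂ '' G₂.graph.neighborSet u₂ = {f₁ v₁} := by
    ext y
    constructor
    · rintro ⟨⟨a, ha, rfl⟩, ⟨b, hb, hab⟩⟩
      rcases M.eq_or_eq hab.symm with ⟨rfl, rfl⟩ | ⟨rfl, rfl⟩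
      · exact (G₂.graph.irrefl hb).elim
      · rfl
    · rintro rfl
      exact ⟨⟨v₁, M.nonCrossing₁.1, rfl⟩, ⟨v₂, M.nonCrossing₂.1, M.map_v.symm⟩⟩
  rw [hn, odd_ncard_union_iff (Set.toFinite _) (Set.toFinite _) hi,
    Set.ncard_image_of_injective _ f₁.injective]
  rwa [Set.ncard_image_of_injective _ f₂.injective]

end MergeData

/-- The vertices of odd degree. -/
def oddVertices {V : Type} (G : OnePlaneGraph V) : Set V := {v | Odd (G.graph.neighborSet v).ncard}

/-- Merging a graph without vertices of odd degree changes the parity of the degree at the two ends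
of the merged edge only. -/
theorem MergeData.oddVertices_merge {V₁ V₂ V : Type} [Finite V] {G₁ : OnePlaneGraph V₁}
    {G₂ : OnePlaneGraph V₂} {f₁ : V₁ ↪ V} {f₂ : V₂ ↪ V} {u₁ v₁ : V₁} {u₂ v₂ : V₂} {T U : Set Plane}
    (M : MergeData G₁ G₂ f₁ f₂ u₁ v₁ u₂ v₂ T U) (h : G₂.oddVertices = ∅) :
    M.merge.oddVertices = f₁ '' symmDiff G₁.oddVertices {u₁, v₁} := by
  have h2 : ∀ b, ¬ Odd (G₂.graph.neighborSet b).ncard := fun b hb =>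
    (h ▸ (show b ∈ G₂.oddVertices from hb) : b ∈ (∅ : Set V₂))
  have hv : Odd (M.merge.graph.neighborSet (f₁ v₁)).ncard ↔
      ¬ Odd (G₁.graph.neighborSet v₁).ncard := by
    have := M.symm.odd_degree_u (h2 _)
    exact this
  have key : ∀ a, f₁ a ∈ M.merge.oddVertices ↔ a ∈ symmDiff G₁.oddVertices {u₁, v₁} := by
    intro a
    have hG : a ∈ G₁.oddVertices ↔ Odd (G₁.graph.neighborSet a).ncard := Iff.rfl
    have hM : f₁ a ∈ M.merge.oddVertices ↔ Odd (M.merge.graph.neighborSet (f₁ a)).ncard := Iff.rfl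
    rw [Set.mem_symmDiff, hM, hG, Set.mem_insert_iff, Set.mem_singleton_iff]
    by_cases hu : a = u₁
    · subst hu
      rw [M.odd_degree_u (h2 _)]
      tauto
    by_cases hv' : a = v₁
    · subst hv'
      rw [hv]
      tauto
    rw [M.neighborSet_left hu hv', Set.ncard_image_of_injective _ f₁.injective]
    tauto
  ext x
  by_cases hx : ∃ a, f₁ a = x
  · obtain ⟨a, rfl⟩ := hx
    rw [key, f₁.injective.mem_set_image]
  · obtain ⟨b, rfl⟩ := (M.exists_preimage x).resolve_left hx
    have hbu : b ≠ u₂ := by rintro rfl; exact hx ⟨_, M.map_u⟩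
    have hbv : b ≠ v₂ := by rintro rfl; exact hx ⟨_, M.map_v⟩
    constructor
    · intro hb
      have hb : Odd (M.merge.graph.neighborSet (f₂ b)).ncard := hb
      rw [M.neighborSet_right hbu hbv, Set.ncard_image_of_injective _ f₂.injective] at hb
      exact (h2 _ hb).elim
    · rintro ⟨a, -, ha⟩
      exact (hx ⟨a, ha⟩).elim

end OnePlaneGraph

/-! ### Tiles

A tile is an optimal 1-plane graph drawn with polygonal edges and integer coordinates inside a
triangle whose base is an edge of the graph. -/

/-- The point of the plane with the given integer coordinates. -/
def latticePoint (p : ℤ × ℤ) : Plane := (p.1, p.2)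

theorem latticePoint_injective : Function.Injective latticePoint := by
  intro p q h
  have h1 := congrArg Prod.fst h
  have h2 := congrArg Prod.snd h
  exact Prod.ext (Int.cast_injective h1) (Int.cast_injective h2)

theorem orient_latticePoint (a b c : ℤ × ℤ) :
    orient (latticePoint a) (latticePoint b) (latticePoint c) = (orient a b c : ℤ) := by
  simp only [orient, latticePoint]
  push_cast
  ring

/-- A segment with integer ends. -/
abbrev LatticeSegment : Type := (ℤ × ℤ) × (ℤ × ℤ)

namespace LatticeSegment

/-- The points of the segment. -/
def carrier (p : LatticeSegment) : Set Plane := segment ℝ (latticePoint p.1) (latticePoint p.2)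

/-- The two segments cross properly. -/
def Crosses (p q : LatticeSegment) : Prop :=
  orient p.1 p.2 q.1 * orient p.1 p.2 q.2 < 0 ∧ orient q.1 q.2 p.1 * orient q.1 q.2 p.2 < 0

instance : DecidableRel Crosses := fun _ _ => inferInstanceAs (Decidable (_ ∧ _))

/-- One of the segments lies strictly on one side of the other one. -/
def Apart (p q : LatticeSegment) : Prop :=
  0 < orient p.1 p.2 q.1 * orient p.1 p.2 q.2 ∨ 0 < orient q.1 q.2 p.1 * orient q.1 q.2 p.2

instance : DecidableRel Apart := fun _ _ => inferInstanceAs (Decidable (_ ∨ _))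

/-- The segments start at the common end `c` in different directions. -/
def HingedAt (c : ℤ × ℤ) (p q : LatticeSegment) : Prop :=
  ((c = p.1 ∧ c = q.1) ∧ orient c p.2 q.2 ≠ 0) ∨ ((c = p.1 ∧ c = q.2) ∧ orient c p.2 q.1 ≠ 0) ∨
    ((c = p.2 ∧ c = q.1) ∧ orient c p.1 q.2 ≠ 0) ∨ ((c = p.2 ∧ c = q.2) ∧ orient c p.1 q.1 ≠ 0)

instance (c : ℤ × ℤ) : DecidableRel (HingedAt c) := fun _ _ => inferInstanceAs (Decidable (_ ∨ _))

/-- A line through two of the given points separates the segment from the open triangle `abc`. -/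
def Avoids (p : LatticeSegment) (a b c : ℤ × ℤ) : Prop :=
  ∃ l ∈ [(a, b), (b, a), (b, c), (c, b), (c, a), (a, c), p, p.swap],
    (0 ≤ orient l.1 l.2 a ∧ 0 ≤ orient l.1 l.2 b ∧ 0 ≤ orient l.1 l.2 c ∧
      0 < orient l.1 l.2 a + orient l.1 l.2 b + orient l.1 l.2 c) ∧
    orient l.1 l.2 p.1 ≤ 0 ∧ orient l.1 l.2 p.2 ≤ 0

instance (p : LatticeSegment) (a b c : ℤ × ℤ) : Decidable (p.Avoids a b c) := by
  unfold Avoids; infer_instance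

variable {p q : LatticeSegment}

theorem isClosed_carrier (p : LatticeSegment) : IsClosed p.carrier := by
  rw [carrier, ← convexHull_pair]
  exact (Set.toFinite _).isClosed_convexHull ℝ

theorem Apart.disjoint (h : p.Apart q) : Disjoint p.carrier q.carrier := by
  rcases h with h | h
  · apply disjoint_segment_of_same_side
    rw [orient_latticePoint, orient_latticePoint]
    exact_mod_cast h
  · apply Disjoint.symm
    apply disjoint_segment_of_same_side
    rw [orient_latticePoint, orient_latticePoint]
    exact_mod_cast h

theorem HingedAt.eq {c : ℤ × ℤ} (h : HingedAt c p q) {x : Plane} (hp : x ∈ p.carrier)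
    (hq : x ∈ q.carrier) : x = latticePoint c := by
  obtain ⟨p1, p2⟩ := p
  obtain ⟨q1, q2⟩ := q
  have key : ∀ {a b : ℤ × ℤ}, orient c a b ≠ 0 →
      x ∈ segment ℝ (latticePoint c) (latticePoint a) →
      x ∈ segment ℝ (latticePoint c) (latticePoint b) → x = latticePoint c := by
    intro a b h
    apply eq_of_mem_segment_of_hinge
    rw [orient_latticePoint]
    exact_mod_cast h
  simp only [carrier] at hp hq
  rcases h with ⟨⟨rfl, rfl⟩, h⟩ | ⟨⟨rfl, rfl⟩, h⟩ | ⟨⟨rfl, rfl⟩, h⟩ | ⟨⟨rfl, rfl⟩, h⟩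
  · exact key h hp hq
  · exact key h hp (by rwa [segment_symm])
  · exact key h (by rwa [segment_symm]) hq
  · exact key h (by rwa [segment_symm]) (by rwa [segment_symm])

theorem Crosses.symm (h : p.Crosses q) : q.Crosses p := ⟨h.2, h.1⟩

theorem Crosses.eq (h : p.Crosses q) {x y : Plane} (hx : x ∈ p.carrier) (hx' : x ∈ q.carrier)
    (hy : y ∈ p.carrier) (hy' : y ∈ q.carrier) : x = y := by
  refine eq_of_mem_crossing ?_ hx hx' hy hy'
  rw [orient_latticePoint, orient_latticePoint]
  exact_mod_cast h.1

theorem Crosses.crossTransversally (h : p.Crosses q) {x : Plane} (hx : x ∈ p.carrier)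
    (hx' : x ∈ q.carrier) : CrossTransversally p.carrier q.carrier x := by
  refine crossTransversally_segment ?_ ?_ hx hx' <;> rw [orient_latticePoint, orient_latticePoint]
  · exact_mod_cast h.1
  · exact_mod_cast h.2

theorem Avoids.disjoint {a b c : ℤ × ℤ} (h : p.Avoids a b c) :
    Disjoint (openTriangle (latticePoint a) (latticePoint b) (latticePoint c)) p.carrier := by
  obtain ⟨l, -, ⟨h1, h2, h3, h4⟩, h5, h6⟩ := h
  refine disjoint_openTriangle_segment (p := latticePoint l.1) (q := latticePoint l.2)
    ?_ ?_ ?_ ?_ ?_ ?_ <;> simp only [orient_latticePoint] <;> exact_mod_cast ‹_›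

end LatticeSegment

/-- An edge of a tile: its ends, and the point where it bends, if any. -/
abbrev TileEdge (k : ℕ) : Type := Fin (k + 2) × Fin (k + 2) × Option (ℤ × ℤ)

/-- A tile with `k + 2` vertices. The vertices `0` and `1` and the point `apex` span the triangle
that contains the drawing; the edge from `1` to `slot` and the point `slotApex` span a triangle that
the drawing avoids. -/
structure Tile (k : ℕ) where
  coords : List (ℤ × ℤ)
  edges : List (TileEdge k)
  apex : ℤ × ℤ
  slot : Fin (k + 2)
  slotApex : ℤ × ℤ

namespace Tile

variable {k : ℕ}

/-- The position of a vertex. -/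
def pt (t : Tile k) (i : Fin (k + 2)) : ℤ × ℤ := t.coords.getD i 0

/-- The segments of which an edge consists. -/
def pieces (t : Tile k) (E : TileEdge k) : List LatticeSegment :=
  match E.2.2 with
  | none => [(t.pt E.1, t.pt E.2.1)]
  | some b => [(t.pt E.1, b), (b, t.pt E.2.1)]

/-- The crossings of an edge: the segment of the edge, the crossing edge and its segment. -/
def crossings (t : Tile k) (E : TileEdge k) : List (LatticeSegment × TileEdge k × LatticeSegment) :=
  (t.pieces E).flatMap fun p => t.edges.flatMap fun F =>
    ((t.pieces F).filter fun q => p.Crosses q).map fun q => (p, F, q)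

/-- The point lies in the interior of the triangle of the tile. -/
def Inside (t : Tile k) (x : ℤ × ℤ) : Prop :=
  0 < orient (t.pt 0) (t.pt 1) x ∧ 0 < orient (t.pt 1) t.apex x ∧ 0 < orient t.apex (t.pt 0) x

instance (t : Tile k) : DecidablePred t.Inside := fun _ => inferInstanceAs (Decidable (_ ∧ _))

/-- The vertices `u` and `v` are adjacent. -/
def Joins (t : Tile k) (u v : Fin (k + 2)) : Prop :=
  ∃ E ∈ t.edges, (E.1 = u ∧ E.2.1 = v) ∨ (E.1 = v ∧ E.2.1 = u)

instance (t : Tile k) : DecidableRel t.Joins := fun u v => by unfold Joins; infer_instance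

/-- The decidable conditions under which a tile has the intended properties. -/
structure Valid (t : Tile k) : Prop where
  lt : ∀ E ∈ t.edges, E.1 < E.2.1
  ends_injective : ∀ E ∈ t.edges, ∀ F ∈ t.edges, E.1 = F.1 → E.2.1 = F.2.1 → E = F
  nodup : t.edges.Nodup
  -- With k + 2 vertices this is the optimal number 4(k + 2) - 8.
  length_edges : t.edges.length = 4 * k
  pt_injective : ∀ i j, t.pt i = t.pt j → i = j
  bend : ∀ E ∈ t.edges, ∀ b ∈ E.2.2, orient b (t.pt E.1) (t.pt E.2.1) ≠ 0
  -- Stronger than necessary, but easy to decide: no other vertex lies even on the line through a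
  -- piece.
  vertex : ∀ E ∈ t.edges, ∀ w, w ≠ E.1 → w ≠ E.2.1 → ∀ p ∈ t.pieces E,
    orient p.1 p.2 (t.pt w) ≠ 0
  -- Pieces of different edges are disjoint, or meet only in a vertex, or cross properly; the last
  -- is allowed only for edges without a common end.
  pair : ∀ E ∈ t.edges, ∀ F ∈ t.edges, E ≠ F → ∀ p ∈ t.pieces E, ∀ q ∈ t.pieces F,
    p.Apart q ∨ (∃ i, LatticeSegment.HingedAt (t.pt i) p q) ∨
      (p.Crosses q ∧ E.1 ≠ F.1 ∧ E.1 ≠ F.2.1 ∧ E.2.1 ≠ F.1 ∧ E.2.1 ≠ F.2.1)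
  single : ∀ E ∈ t.edges, (t.crossings E).length ≤ 1
  even : ∀ v, Even (Finset.univ.filter fun w => t.Joins v w).card
  base_mem : (0, 1, none) ∈ t.edges
  inside : ∀ w, w ≠ 0 → w ≠ 1 → t.Inside (t.pt w)
  bend_inside : ∀ E ∈ t.edges, ∀ b ∈ E.2.2, t.Inside b
  apex_pos : 0 < orient (t.pt 0) (t.pt 1) t.apex
  exists_edge : ∀ w, ∃ E ∈ t.edges, E.1 = w ∨ E.2.1 = w
  slot_mem : (1, t.slot, none) ∈ t.edges
  slot_crossings : t.crossings (1, t.slot, none) = []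
  slotApex_inside : t.Inside t.slotApex
  slotApex_ne : orient (t.pt 1) (t.pt t.slot) t.slotApex ≠ 0
  slot_empty : ∀ E ∈ t.edges, ∀ p ∈ t.pieces E, p.Avoids (t.pt 1) (t.pt t.slot) t.slotApex

theorem mem_crossings {t : Tile k} {E F : TileEdge k} {p q : LatticeSegment} :
    (p, F, q) ∈ t.crossings E ↔ p ∈ t.pieces E ∧ F ∈ t.edges ∧ q ∈ t.pieces F ∧ p.Crosses q := by
  simp only [crossings, List.mem_flatMap, List.mem_map, List.mem_filter, decide_eq_true_eq,
    Prod.mk.injEq]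
  constructor
  · rintro ⟨p, hp, F, hF, q, ⟨hq, h⟩, rfl, rfl, rfl⟩
    exact ⟨hp, hF, hq, h⟩
  · rintro ⟨hp, hF, hq, h⟩
    exact ⟨p, hp, F, hF, q, ⟨hq, h⟩, rfl, rfl, rfl⟩

/-- The graph of a tile. -/
def graph (t : Tile k) : SimpleGraph (Fin (k + 2)) :=
  SimpleGraph.fromEdgeSet {e | ∃ E ∈ t.edges, s(E.1, E.2.1) = e}

/-- The drawing of a pair of vertices. -/
def arc (t : Tile k) (e : Sym2 (Fin (k + 2))) : Set Plane :=
  {x | ∃ E ∈ t.edges, s(E.1, E.2.1) = e ∧ ∃ p ∈ t.pieces E, x ∈ p.carrier}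

/-! ### The 1-plane graph of a valid tile -/

namespace Valid

variable {t : Tile k}

theorem edgeSet_graph (h : t.Valid) : t.graph.edgeSet = {e | ∃ E ∈ t.edges, s(E.1, E.2.1) = e} := by
  rw [graph, SimpleGraph.edgeSet_fromEdgeSet, sdiff_eq_left, Set.disjoint_left]
  rintro _ ⟨E, hE, rfl⟩ hd
  exact (h.lt E hE).ne (Sym2.mk_isDiag_iff.1 hd)

theorem adj_iff (h : t.Valid) {u v : Fin (k + 2)} : t.graph.Adj u v ↔ t.Joins u v := by
  rw [← SimpleGraph.mem_edgeSet, h.edgeSet_graph, Joins, mem_ofPred_eq]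
  simp only [Sym2.eq_iff]

theorem key_injective (h : t.Valid) {E F : TileEdge k} (hE : E ∈ t.edges) (hF : F ∈ t.edges)
    (he : s(E.1, E.2.1) = s(F.1, F.2.1)) : E = F := by
  rcases Sym2.eq_iff.1 he with ⟨h1, h2⟩ | ⟨h1, h2⟩
  · exact h.ends_injective E hE F hF h1 h2
  · have := h.lt E hE
    have := h.lt F hF
    omega

theorem mem_arc (h : t.Valid) {E : TileEdge k} (hE : E ∈ t.edges) {x : Plane} :
    x ∈ t.arc s(E.1, E.2.1) ↔ ∃ p ∈ t.pieces E, x ∈ p.carrier := by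
  constructor
  · rintro ⟨F, hF, he, hx⟩
    rwa [h.key_injective hE hF he.symm]
  · exact fun hx => ⟨E, hE, rfl, hx⟩

theorem arc_of_straight (h : t.Valid) {i j : Fin (k + 2)} (hE : (i, j, none) ∈ t.edges) :
    t.arc s(i, j) = segment ℝ (latticePoint (t.pt i)) (latticePoint (t.pt j)) := by
  ext x
  rw [h.mem_arc (E := (i, j, none)) hE]
  simp [pieces, LatticeSegment.carrier]

theorem isArc (h : t.Valid) {E : TileEdge k} (hE : E ∈ t.edges) :
    IsArc (latticePoint (t.pt E.1)) (latticePoint (t.pt E.2.1)) (t.arc s(E.1, E.2.1)) := by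
  obtain ⟨i, j, b⟩ := E
  cases b with
  | none =>
    rw [h.arc_of_straight hE]
    exact isArc_segment fun he =>
      (h.lt _ hE).ne (h.pt_injective _ _ (latticePoint_injective he))
  | some b =>
    have hb := h.bend _ hE b rfl
    have harc : t.arc s(i, j) = segment ℝ (latticePoint (t.pt i)) (latticePoint b) ∪
        segment ℝ (latticePoint b) (latticePoint (t.pt j)) := by
      ext x
      rw [h.mem_arc (E := (i, j, some b)) hE]
      simp [pieces, LatticeSegment.carrier]
    rw [harc]
    refine (isArc_segment ?_).union (isArc_segment ?_) ?_
    · intro he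
      apply hb
      rw [← latticePoint_injective he]
      simp only [orient]
      ring
    · intro he
      apply hb
      rw [latticePoint_injective he]
      simp only [orient]
      ring
    · rintro x ⟨h1, h2⟩
      rw [segment_symm] at h1
      refine eq_of_mem_segment_of_hinge ?_ h1 h2
      rw [orient_latticePoint]
      exact_mod_cast hb

/-- The drawing of a tile. -/
def drawing (h : t.Valid) : Drawing t.graph where
  point i := latticePoint (t.pt i)
  arc := t.arc
  point_injective i j hij := h.pt_injective i j (latticePoint_injective hij)
  isArc := by
    intro u v huv
    obtain ⟨E, hE, ⟨rfl, rfl⟩ | ⟨rfl, rfl⟩⟩ := h.adj_iff.1 huv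
    · exact h.isArc hE
    · rw [Sym2.eq_swap]
      exact (h.isArc hE).symm
  mem_of_point_mem := by
    rintro e - w ⟨E, hE, rfl, p, hp, hw⟩
    by_contra hmem
    rw [Sym2.mem_iff, not_or] at hmem
    apply h.vertex E hE w hmem.1 hmem.2 p hp
    have := orient_eq_zero_of_mem_segment hw
    rw [orient_latticePoint] at this
    exact_mod_cast this

theorem crosses_of_mem (h : t.Valid) {E F : TileEdge k} (hE : E ∈ t.edges) (hF : F ∈ t.edges)
    (hne : E ≠ F) {p q : LatticeSegment} (hp : p ∈ t.pieces E) (hq : q ∈ t.pieces F) {x : Plane}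
    (hx : x ∈ p.carrier) (hx' : x ∈ q.carrier) (hr : x ∉ range h.drawing.point) :
    p.Crosses q ∧ E.1 ≠ F.1 ∧ E.1 ≠ F.2.1 ∧ E.2.1 ≠ F.1 ∧ E.2.1 ≠ F.2.1 := by
  rcases h.pair E hE F hF hne p hp q hq with h' | ⟨i, h'⟩ | h'
  · exact (Set.disjoint_left.1 h'.disjoint hx hx').elim
  · exact (hr ⟨i, (h'.eq hx hx').symm⟩).elim
  · exact h'

theorem exists_of_crossAt (h : t.Valid) {e f : Sym2 (Fin (k + 2))} {x : Plane}
    (hx : h.drawing.CrossAt e f x) :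
    ∃ E ∈ t.edges, ∃ F ∈ t.edges, s(E.1, E.2.1) = e ∧ s(F.1, F.2.1) = f ∧ E ≠ F ∧
      ∃ p ∈ t.pieces E, ∃ q ∈ t.pieces F, x ∈ p.carrier ∧ x ∈ q.carrier := by
  obtain ⟨-, -, hne, ⟨E, hE, rfl, p, hp, hxp⟩, ⟨F, hF, rfl, q, hq, hxq⟩, -⟩ := hx
  exact ⟨E, hE, F, hF, rfl, rfl, fun h => hne (by rw [h]), p, hp, q, hq, hxp, hxq⟩

theorem eq_of_mem_crossings (h : t.Valid) {E : TileEdge k} (hE : E ∈ t.edges)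
    {c d : LatticeSegment × TileEdge k × LatticeSegment} (hc : c ∈ t.crossings E)
    (hd : d ∈ t.crossings E) : c = d := by
  have key : ∀ l : List (LatticeSegment × TileEdge k × LatticeSegment), l.length ≤ 1 →
      c ∈ l → d ∈ l → c = d := by
    intro l hl hc hd
    obtain ⟨i, hi, rfl⟩ := List.getElem_of_mem hc
    obtain ⟨j, hj, rfl⟩ := List.getElem_of_mem hd
    congr 1
    omega
  exact key _ (h.single E hE) hc hd

/-- Each crossing point of an edge yields an entry of its list `crossings`, which has at most one
entry; the two pieces in that entry determine the point. -/
theorem isOnePlanar (h : t.Valid) : h.drawing.IsOnePlanar := by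
  intro e f g x y hx hy
  obtain ⟨E, hE, F, hF, rfl, rfl, hne, p, hp, q, hq, h1, h2⟩ := h.exists_of_crossAt hx
  obtain ⟨E', hE', F', hF', he, rfl, hne', p', hp', q', hq', h1', h2'⟩ := h.exists_of_crossAt hy
  obtain rfl := h.key_injective hE' hE he
  have c := (h.crosses_of_mem hE hF hne hp hq h1 h2 hx.2.2.2.2.2).1
  have c' := (h.crosses_of_mem hE hF' hne' hp' hq' h1' h2' hy.2.2.2.2.2).1
  have := h.eq_of_mem_crossings hE (mem_crossings.2 ⟨hp, hF, hq, c⟩)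
    (mem_crossings.2 ⟨hp', hF', hq', c'⟩)
  obtain ⟨rfl, rfl, rfl⟩ : p = p' ∧ F = F' ∧ q = q' := by simpa using this
  have hxy : x = y := c.eq h1 h2 h1' h2'
  exact ⟨rfl, hxy⟩

/-- Near a crossing, an edge coincides with one of its segments. -/
theorem exists_nhds (h : t.Valid) {E F : TileEdge k} (hE : E ∈ t.edges) (hF : F ∈ t.edges)
    (hne : E ≠ F) {p q : LatticeSegment} (hp : p ∈ t.pieces E) (hq : q ∈ t.pieces F) {x : Plane}
    (hx : x ∈ p.carrier) (hx' : x ∈ q.carrier) (hr : x ∉ range h.drawing.point) :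
    ∃ U : Set Plane, IsOpen U ∧ x ∈ U ∧ ∀ y ∈ U, y ∈ t.arc s(E.1, E.2.1) ↔ y ∈ p.carrier := by
  have hfin : {p' | p' ∈ t.pieces E ∧ p' ≠ p}.Finite :=
    (List.finite_toSet (t.pieces E)).subset fun _ h => h.1
  refine ⟨(⋃ p' ∈ {p' | p' ∈ t.pieces E ∧ p' ≠ p}, p'.carrier)ᶜ,
    (hfin.isClosed_biUnion fun p' _ => p'.isClosed_carrier).isOpen_compl, ?_, ?_⟩
  -- If x also lay on another piece of the same edge, the list `crossings` would have two different
  -- entries.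
  · intro hmem
    obtain ⟨p', ⟨hp', hne'⟩, hx''⟩ := mem_iUnion₂.1 hmem
    have c := (h.crosses_of_mem hE hF hne hp hq hx hx' hr).1
    have c' := (h.crosses_of_mem hE hF hne hp' hq hx'' hx' hr).1
    have := h.eq_of_mem_crossings hE (mem_crossings.2 ⟨hp', hF, hq, c'⟩)
      (mem_crossings.2 ⟨hp, hF, hq, c⟩)
    exact hne' (congrArg Prod.fst this)
  · intro y hy
    rw [h.mem_arc hE]
    constructor
    · rintro ⟨p', hp', hyp⟩
      by_cases he : p' = p
      · rwa [← he]
      · exact (hy (mem_iUnion₂.2 ⟨p', ⟨hp', he⟩, hyp⟩)).elim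
    · exact fun hyp => ⟨p, hp, hyp⟩

theorem isGood (h : t.Valid) : h.drawing.IsGood := by
  refine Drawing.isGood_of_isOnePlanar h.isOnePlanar ?_ ?_
  · intro e f w hw hw' x hx
    obtain ⟨E, hE, F, hF, rfl, rfl, hne, p, hp, q, hq, h1, h2⟩ := h.exists_of_crossAt hx
    obtain ⟨-, n1, n2, n3, n4⟩ := h.crosses_of_mem hE hF hne hp hq h1 h2 hx.2.2.2.2.2
    rcases Sym2.mem_iff.1 hw with rfl | rfl <;> rcases Sym2.mem_iff.1 hw' with h' | h'
    exacts [n1 h', n2 h', n3 h', n4 h']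
  · intro e f x hx
    have hr := hx.2.2.2.2.2
    obtain ⟨E, hE, F, hF, rfl, rfl, hne, p, hp, q, hq, h1, h2⟩ := h.exists_of_crossAt hx
    have c := (h.crosses_of_mem hE hF hne hp hq h1 h2 hr).1
    obtain ⟨U, hU, hxU, HU⟩ := h.exists_nhds hE hF hne hp hq h1 h2 hr
    obtain ⟨W, hW, hxW, HW⟩ := h.exists_nhds hF hE hne.symm hq hp h2 h1 hr
    exact (c.crossTransversally h1 h2).congr (hU.inter hW) ⟨hxU, hxW⟩ (fun y hy => HU y hy.1)
      fun y hy => HW y hy.2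

/-- The 1-plane graph of a tile. -/
def onePlaneGraph (h : t.Valid) : OnePlaneGraph (Fin (k + 2)) where
  finite := inferInstance
  graph := t.graph
  drawing := h.drawing
  good := h.isGood
  onePlanar := h.isOnePlanar

theorem ncard_edgeSet (h : t.Valid) : t.graph.edgeSet.ncard = 4 * k := by
  classical
  have : t.graph.edgeSet =
      (fun E : TileEdge k => s(E.1, E.2.1)) '' (t.edges.toFinset : Set (TileEdge k)) := by
    rw [h.edgeSet_graph]
    ext e
    simp
  have hinj : Set.InjOn (fun E : TileEdge k => s(E.1, E.2.1))
      (t.edges.toFinset : Set (TileEdge k)) := fun E hE F hF he =>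
    h.key_injective (by simpa using hE) (by simpa using hF) he
  rw [this, hinj.ncard_image, Set.ncard_coe_finset, List.toFinset_card_of_nodup h.nodup,
    h.length_edges]

theorem isOptimal (h : t.Valid) : h.onePlaneGraph.IsOptimal := by
  have hk : 0 < t.edges.length := List.length_pos_of_mem h.base_mem
  rw [h.length_edges] at hk
  refine ⟨?_, ?_⟩
  · rw [Nat.card_eq_fintype_card, Fintype.card_fin]
    omega
  · change t.graph.edgeSet.ncard + 8 = _
    rw [h.ncard_edgeSet, Nat.card_eq_fintype_card, Fintype.card_fin]
    ring

theorem oddVertices (h : t.Valid) : h.onePlaneGraph.oddVertices = ∅ := by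
  rw [Set.eq_empty_iff_forall_notMem]
  intro v hv
  have hv : Odd (t.graph.neighborSet v).ncard := hv
  have : t.graph.neighborSet v =
      ((Finset.univ.filter fun w => t.Joins v w : Finset _) : Set _) := by
    ext w
    simp [h.adj_iff]
  rw [this, Set.ncard_coe_finset] at hv
  exact Nat.not_odd_iff_even.2 (h.even v) hv

/-! ### The triangle around a tile, its base and its slot -/

/-- The triangle that contains the drawing. -/
def region (_ : t.Valid) : Set Plane :=
  openTriangle (latticePoint (t.pt 0)) (latticePoint (t.pt 1)) (latticePoint t.apex)

theorem mem_region (h : t.Valid) {x : ℤ × ℤ} (hx : t.Inside x) : latticePoint x ∈ h.region := by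
  apply mem_openTriangle <;> rw [orient_latticePoint]
  · exact_mod_cast hx.1
  · exact_mod_cast hx.2.1
  · exact_mod_cast hx.2.2

theorem point_mem_region (h : t.Valid) (w : Fin (k + 2)) : latticePoint (t.pt w) ∈ h.region ∨
    latticePoint (t.pt w) = latticePoint (t.pt 0) ∨
    latticePoint (t.pt w) = latticePoint (t.pt 1) := by
  by_cases h0 : w = 0
  · subst h0; simp
  by_cases h1 : w = 1
  · subst h1; simp
  exact Or.inl (h.mem_region (h.inside w h0 h1))

/-- Every piece of an edge other than the base has an end in the open triangle: the bend, or, for a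
straight edge, the larger end, which is neither 0 nor 1. -/
theorem mem_region_of_mem_arc (h : t.Valid) {E : TileEdge k} (hE : E ∈ t.edges)
    (hne : E ≠ (0, 1, none)) {x : Plane} (hx : x ∈ t.arc s(E.1, E.2.1)) :
    x ∈ h.region ∨ x = latticePoint (t.pt 0) ∨ x = latticePoint (t.pt 1) := by
  obtain ⟨p, hp, hx⟩ := (h.mem_arc hE).1 hx
  obtain ⟨i, j, b⟩ := E
  cases b with
  | none =>
    obtain rfl : p = (t.pt i, t.pt j) := by simpa [pieces] using hp
    have hij : i < j := h.lt _ hE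
    have h1 : j ≠ 1 := by
      rintro rfl
      have hi : i = 0 := Fin.lt_one_iff _ |>.1 hij
      subst hi
      exact hne (h.ends_injective _ hE _ h.base_mem rfl rfl)
    have h0 : j ≠ 0 := by rintro rfl; exact absurd hij (Fin.not_lt_zero _)
    rw [LatticeSegment.carrier, segment_symm] at hx
    exact mem_openTriangle_of_mem_segment (h.mem_region (h.inside j h0 h1))
      (h.point_mem_region i) hx
  | some b =>
    have hb := h.mem_region (h.bend_inside _ hE b rfl)
    obtain rfl | rfl : p = (t.pt i, b) ∨ p = (b, t.pt j) := by simpa [pieces] using hp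
    · rw [LatticeSegment.carrier, segment_symm] at hx
      exact mem_openTriangle_of_mem_segment hb (h.point_mem_region i) hx
    · exact mem_openTriangle_of_mem_segment hb (h.point_mem_region j) hx

theorem image_subset (h : t.Valid) :
    h.drawing.image ⊆ h.region ∪ h.drawing.arc s(0, 1) := by
  have hb : h.drawing.arc s(0, 1) =
      segment ℝ (latticePoint (t.pt 0)) (latticePoint (t.pt 1)) := h.arc_of_straight h.base_mem
  have key : ∀ x, (x ∈ h.region ∨ x = latticePoint (t.pt 0) ∨ x = latticePoint (t.pt 1)) →
      x ∈ h.region ∪ h.drawing.arc s(0, 1) := by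
    rintro x (hx | rfl | rfl)
    · exact Or.inl hx
    · exact Or.inr (hb ▸ left_mem_segment ℝ _ _)
    · exact Or.inr (hb ▸ right_mem_segment ℝ _ _)
  rintro x (⟨w, rfl⟩ | hx)
  · exact key _ (h.point_mem_region w)
  · obtain ⟨e, he, hx⟩ := mem_iUnion₂.1 hx
    rw [h.edgeSet_graph] at he
    obtain ⟨E, hE, rfl⟩ := he
    by_cases hne : E = (0, 1, none)
    · subst hne
      exact Or.inr hx
    · exact key _ (h.mem_region_of_mem_arc hE hne hx)

theorem apex_pos' (h : t.Valid) :
    0 < orient (latticePoint (t.pt 0)) (latticePoint (t.pt 1)) (latticePoint t.apex) := by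
  rw [orient_latticePoint]
  exact_mod_cast h.apex_pos

/-- Apart from the points 0 and 1, all other edges lie strictly above the line of the base. -/
theorem nonCrossing_base (h : t.Valid) : h.drawing.NonCrossing s(0, 1) := by
  refine ⟨by rw [h.edgeSet_graph]; exact ⟨_, h.base_mem, rfl⟩, fun f x hx => ?_⟩
  obtain ⟨-, hf, hne, hx0, hxf, hr⟩ := hx
  rw [h.edgeSet_graph] at hf
  obtain ⟨F, hF, rfl⟩ := hf
  rcases h.mem_region_of_mem_arc hF (by rintro rfl; exact hne rfl) hxf with hx | hx | hx
  · have h1 := orient_pos_of_mem_openTriangle h.apex_pos' hx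
    have hb : h.drawing.arc s(0, 1) =
      segment ℝ (latticePoint (t.pt 0)) (latticePoint (t.pt 1)) := h.arc_of_straight h.base_mem
    rw [hb] at hx0
    have h2 := orient_eq_zero_of_mem_segment hx0
    linarith
  · exact hr ⟨0, hx.symm⟩
  · exact hr ⟨1, hx.symm⟩

theorem nonCrossing_slot (h : t.Valid) : h.drawing.NonCrossing s(1, t.slot) := by
  refine ⟨by rw [h.edgeSet_graph]; exact ⟨_, h.slot_mem, rfl⟩, fun f x hx => ?_⟩
  obtain ⟨E, hE, F, hF, he, rfl, hne, p, hp, q, hq, h1, h2⟩ := h.exists_of_crossAt hx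
  obtain rfl := h.key_injective hE h.slot_mem he
  have c := (h.crosses_of_mem hE hF hne hp hq h1 h2 hx.2.2.2.2.2).1
  have := mem_crossings.2 ⟨hp, hF, hq, c⟩
  rw [h.slot_crossings] at this
  exact absurd this List.not_mem_nil

/-- The triangle at the slot. -/
def slotRegion (_ : t.Valid) : Set Plane :=
  openTriangle (latticePoint (t.pt 1)) (latticePoint (t.pt t.slot)) (latticePoint t.slotApex)

theorem one_lt_slot (h : t.Valid) : 1 < t.slot := h.lt _ h.slot_mem

theorem slotRegion_subset (h : t.Valid) : h.slotRegion ⊆ h.region := by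
  have h1 := h.one_lt_slot
  refine openTriangle_subset (h.mem_region (h.inside _ ?_ h1.ne')) (h.mem_region h.slotApex_inside)
  intro h0
  rw [h0] at h1
  exact absurd h1 (Fin.not_lt_zero _)

theorem disjoint_slotRegion (h : t.Valid) : Disjoint h.slotRegion h.drawing.image := by
  have key : ∀ E ∈ t.edges, ∀ x ∈ t.arc s(E.1, E.2.1), x ∉ h.slotRegion := by
    intro E hE x hx hxs
    obtain ⟨p, hp, hx⟩ := (h.mem_arc hE).1 hx
    exact Set.disjoint_left.1 (h.slot_empty E hE p hp).disjoint hxs hx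
  rw [Set.disjoint_right]
  rintro x (⟨w, rfl⟩ | hx)
  · obtain ⟨E, hE, hw⟩ := h.exists_edge w
    apply key E hE
    obtain ⟨γ, -, hγ⟩ := h.isArc hE
    rw [← hγ]
    rcases hw with rfl | rfl
    · exact ⟨0, γ.source⟩
    · exact ⟨1, γ.target⟩
  · obtain ⟨e, he, hx⟩ := mem_iUnion₂.1 hx
    rw [h.edgeSet_graph] at he
    obtain ⟨E, hE, rfl⟩ := he
    exact key E hE x hx

/-- The open half-plane below the base of a tile. -/
def below (_ : t.Valid) : Set Plane :=
  {x | orient (latticePoint (t.pt 0)) (latticePoint (t.pt 1)) x < 0}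

theorem disjoint_below (h : t.Valid) : Disjoint h.below h.drawing.image := by
  rw [Set.disjoint_right]
  intro x hx hxb
  have hxb : orient (latticePoint (t.pt 0)) (latticePoint (t.pt 1)) x < 0 := hxb
  rcases h.image_subset hx with hx | hx
  · have := orient_pos_of_mem_openTriangle h.apex_pos' hx
    linarith
  · have hb : h.drawing.arc s(0, 1) =
      segment ℝ (latticePoint (t.pt 0)) (latticePoint (t.pt 1)) := h.arc_of_straight h.base_mem
    rw [hb] at hx
    have := orient_eq_zero_of_mem_segment hx
    linarith

end Valid

end Tile

/-! ### Half-planes, which put the base on the boundary of the infinite face -/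

theorem convex_halfPlane (a b : Plane) : Convex ℝ {x | orient a b x < 0} := by
  intro x hx y hy s t hs ht hst
  have hx : orient a b x < 0 := hx
  have hy : orient a b y < 0 := hy
  change orient a b (s • x + t • y) < 0
  rw [orient_combo _ _ _ _ hst]
  rcases hs.eq_or_lt with rfl | hs
  · obtain rfl : t = 1 := by linarith
    linarith
  · have := mul_neg_of_pos_of_neg hs hx
    have := mul_nonpos_of_nonneg_of_nonpos ht hy.le
    linarith

/-- The point `x`, moved by `r` times the vector from `c` to `a`. -/
theorem orient_add_smul_sub (a b c x : Plane) (r : ℝ) :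
    orient a b (x + r • (a - c)) = orient a b x - r * orient a b c := by
  simp only [orient, Prod.fst_add, Prod.snd_add, Prod.smul_fst, Prod.smul_snd, smul_eq_mul,
    Prod.fst_sub, Prod.snd_sub]
  ring

theorem segment_subset_closure_halfPlane {a b c : Plane} (h : 0 < orient a b c) :
    segment ℝ a b ⊆ closure {x | orient a b x < 0} := by
  intro x hx
  have key : Filter.Tendsto (fun r : ℝ => x + r • (a - c)) (𝓝[>] 0) (𝓝 x) := by
    have : ContinuousAt (fun r : ℝ => x + r • (a - c)) 0 := by fun_prop
    have h := this.tendsto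
    simp only [zero_smul, add_zero] at h
    exact h.mono_left nhdsWithin_le_nhds
  refine mem_closure_of_tendsto key ?_
  filter_upwards [self_mem_nhdsWithin] with r hr
  have := mul_pos (show 0 < r from hr) h
  change orient a b (x + r • (a - c)) < 0
  rw [orient_add_smul_sub, orient_eq_zero_of_mem_segment hx]
  linarith

/-- The area over ab would be bounded below on a bounded half-plane, but it tends to minus infinity
along the ray from a in direction a - c. -/
theorem not_isBounded_halfPlane {a b c : Plane} (h : 0 < orient a b c) :
    ¬ Bornology.IsBounded {x | orient a b x < 0} := by
  intro hb
  have hcont : Continuous (orient a b) := by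
    unfold orient
    fun_prop
  have hc := (hb.isCompact_closure.image hcont).isBounded
  obtain ⟨m, hm⟩ := hc.bddBelow
  obtain ⟨n, hn⟩ := exists_nat_gt (max (-m) 0 / orient a b c)
  rw [div_lt_iff₀ h] at hn
  have ha : orient a b a = 0 := by simp only [orient]; ring
  have hval : orient a b (a + (n : ℝ) • (a - c)) = -(n * orient a b c) := by
    rw [orient_add_smul_sub, ha]
    ring
  have h1 : orient a b (a + (n : ℝ) • (a - c)) < 0 := by
    rw [hval]
    linarith [le_max_right (-m) 0]
  have h2 := hm ⟨_, subset_closure h1, rfl⟩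
  rw [hval] at h2
  linarith [le_max_left (-m) 0]

/-! ### The four tiles -/

/-- The cube with the diagonals of its faces. -/
def cubeTile : Tile 6 where
  coords :=
    [(0, 0), (20, 0), (16, 12), (4, 12), (9, 8), (13, 7), (9, 5), (13, 5)]
  edges :=
    -- In all four tiles the outer face of the quadrangulation is 0123. Its diagonals 02 and 13 are
    -- drawn outside it, hence the two bends. All degrees are even, since a vertex has as many
    -- diagonals as edges of the quadrangulation.
    [(0, 1, none), (0, 2, some (6, 20)), (0, 3, none), (0, 4, none), (0, 6, none), (0, 7, none),
     (1, 2, none), (1, 3, some (14, 20)), (1, 5, none), (1, 6, none), (1, 7, none), (2, 3, none),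
     (2, 4, none), (2, 5, none), (2, 7, none), (3, 4, none), (3, 5, none), (3, 6, none),
     (4, 5, none), (4, 6, none), (4, 7, none), (5, 6, none), (5, 7, none), (6, 7, none)]
  apex := (10, 40)
  slot := 7
  slotApex := (14, 3)

/-- The pseudo-double wheel over an octagon with the diagonals of its faces. -/
def octagonTile : Tile 8 where
  coords :=
    [(0, 0), (20, 0), (16, 12), (4, 12), (5, 3), (6, 9), (10, 7), (9, 10), (13, 9), (13, 5)]
  edges :=
    [(0, 1, none), (0, 2, some (6, 20)), (0, 3, none), (0, 4, none), (0, 5, none), (0, 9, none),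
     (1, 2, none), (1, 3, some (14, 20)), (1, 4, none), (1, 8, none), (1, 9, none), (2, 3, none),
     (2, 7, none), (2, 8, none), (2, 9, none), (3, 4, none), (3, 5, none), (3, 6, none),
     (3, 7, none), (3, 8, none), (4, 5, none), (4, 6, none), (4, 9, none), (5, 6, none),
     (5, 7, none), (5, 9, none), (6, 7, none), (6, 8, none), (6, 9, none), (7, 8, none),
     (7, 9, none), (8, 9, none)]
  apex := (10, 40)
  slot := 9
  slotApex := (12, 3)

/-- The Herschel graph with the diagonals of its faces. -/
def herschelTile : Tile 9 where
  coords :=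
    [(0, 0), (20, 0), (16, 12), (4, 12), (13, 8), (7, 8), (8, 5), (12, 3), (5, 4), (7, 4), (6, 2)]
  edges :=
    [(0, 1, none), (0, 2, some (6, 20)), (0, 3, none), (0, 5, none), (0, 7, none), (0, 8, none),
     (0, 9, none), (0, 10, none), (1, 2, none), (1, 3, some (14, 20)), (1, 4, none), (1, 7, none),
     (1, 10, none), (2, 3, none), (2, 4, none), (2, 5, none), (2, 7, none), (3, 4, none),
     (3, 5, none), (3, 8, none), (4, 5, none), (4, 6, none), (4, 7, none), (5, 6, none),
     (5, 7, none), (5, 8, none), (5, 9, none), (6, 7, none), (6, 8, none), (6, 9, none),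
     (6, 10, none), (7, 9, none), (7, 10, none), (8, 9, none), (8, 10, none), (9, 10, none)]
  apex := (10, 40)
  slot := 7
  slotApex := (12, 2)

/-- The pseudo-double wheel over a decagon with the diagonals of its faces. -/
def decagonTile : Tile 10 where
  coords :=
    [(0, 0), (20, 0), (16, 12), (4, 12), (13, 5), (15, 3), (13, 4), (10, 7), (15, 1), (6, 2),
     (14, 7), (16, 4)]
  edges :=
    [(0, 1, none), (0, 2, some (6, 20)), (0, 3, none), (0, 7, none), (0, 8, none), (0, 9, none),
     (1, 2, none), (1, 3, some (14, 20)), (1, 4, none), (1, 5, none), (1, 6, none), (1, 8, none),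
     (1, 9, none), (1, 10, none), (1, 11, none), (2, 3, none), (2, 7, none), (2, 10, none),
     (2, 11, none), (3, 7, none), (3, 9, none), (3, 10, none), (4, 5, none), (4, 6, none),
     (4, 7, none), (4, 10, none), (4, 11, none), (5, 6, none), (5, 7, none), (5, 8, none),
     (5, 11, none), (6, 7, none), (6, 8, none), (6, 9, none), (7, 8, none), (7, 9, none),
     (7, 10, none), (7, 11, none), (8, 9, none), (10, 11, none)]
  apex := (10, 40)
  slot := 8
  slotApex := (16, 1)

theorem cubeTile_valid : cubeTile.Valid := by
  constructor <;> decide +kernel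

theorem octagonTile_valid : octagonTile.Valid := by
  constructor <;> decide +kernel

theorem herschelTile_valid : herschelTile.Valid := by
  constructor <;> decide +kernel

theorem decagonTile_valid : decagonTile.Valid := by
  constructor <;> decide +kernel

/-! ### Merging tiles into slots -/

namespace OnePlaneGraph

/-- The straight uncrossed edge `vw` and the point `r` span a triangle that the drawing avoids. -/
structure HasSlot {V : Type} (G : OnePlaneGraph V) (v w : V) (r : Plane) : Prop where
  nonCrossing : G.drawing.NonCrossing s(v, w)
  arc_eq : G.drawing.arc s(v, w) = segment ℝ (G.drawing.point v) (G.drawing.point w)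
  orient_ne : orient (G.drawing.point v) (G.drawing.point w) r ≠ 0
  disjoint : Disjoint (openTriangle (G.drawing.point v) (G.drawing.point w) r) G.drawing.image

end OnePlaneGraph

/-- The inclusion of the vertices of a tile: the vertices `0` and `1` become `v` and `w`. -/
def glue {n : ℕ} (k : ℕ) (v w : Fin n) : Fin (k + 2) → Fin (n + k) :=
  Fin.cases (Fin.castAdd k v) (Fin.cases (Fin.castAdd k w) (Fin.natAdd n))

section glue

variable {n k : ℕ} {v w : Fin n}

theorem castAdd_ne_natAdd (a : Fin n) (i : Fin k) : Fin.castAdd k a ≠ Fin.natAdd n i := by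
  intro h
  have := congrArg Fin.val h
  simp only [Fin.val_castAdd, Fin.val_natAdd] at this
  omega

theorem eq_of_castAdd_eq_glue {a : Fin n} {i : Fin (k + 2)} (h : Fin.castAdd k a = glue k v w i) :
    i = 0 ∨ i = 1 := by
  induction i using Fin.cases with
  | zero => exact Or.inl rfl
  | succ i =>
    induction i using Fin.cases with
    | zero => exact Or.inr rfl
    | succ i => exact (castAdd_ne_natAdd a i h).elim

theorem glue_injective (h : v ≠ w) : Function.Injective (glue k v w) := by
  have h' : Fin.castAdd k v ≠ Fin.castAdd k w := fun e => h (Fin.castAdd_injective n k e)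
  intro i j hij
  induction i using Fin.cases with
  | zero =>
    rcases eq_of_castAdd_eq_glue (a := v) hij with rfl | rfl
    · rfl
    · exact (h' hij).elim
  | succ i =>
    induction i using Fin.cases with
    | zero =>
      rcases eq_of_castAdd_eq_glue (a := w) hij with rfl | rfl
      · exact (h' hij.symm).elim
      · rfl
    | succ i =>
      induction j using Fin.cases with
      | zero => exact (castAdd_ne_natAdd v i hij.symm).elim
      | succ j =>
        induction j using Fin.cases with
        | zero => exact (castAdd_ne_natAdd w i hij.symm).elim
        | succ j => exact congrArg (fun i : Fin k => i.succ.succ) (Fin.natAdd_injective k n hij)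

theorem range_union_glue :
    range (Fin.castAdd k : Fin n → Fin (n + k)) ∪ range (glue k v w) = univ := by
  rw [Set.eq_univ_iff_forall]
  intro x
  induction x using Fin.addCases with
  | left a => exact Or.inl ⟨a, rfl⟩
  | right i => exact Or.inr ⟨i.succ.succ, rfl⟩

theorem range_inter_glue :
    range (Fin.castAdd k : Fin n → Fin (n + k)) ∩ range (glue k v w) =
      {Fin.castAdd k v, Fin.castAdd k w} := by
  ext x
  constructor
  · rintro ⟨⟨a, rfl⟩, ⟨i, hi⟩⟩
    rcases eq_of_castAdd_eq_glue hi.symm with rfl | rfl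
    · exact Or.inl hi.symm
    · exact Or.inr hi.symm
  · rintro (rfl | rfl)
    · exact ⟨⟨v, rfl⟩, ⟨0, rfl⟩⟩
    · exact ⟨⟨w, rfl⟩, ⟨1, rfl⟩⟩

end glue

namespace OnePlaneGraph

theorem _root_.Tile.Valid.hasSlot {k : ℕ} {t : Tile k} (h : t.Valid) :
    h.onePlaneGraph.HasSlot 1 t.slot (latticePoint t.slotApex) where
  nonCrossing := h.nonCrossing_slot
  arc_eq := h.arc_of_straight h.slot_mem
  orient_ne := by
    change orient (latticePoint _) (latticePoint _) _ ≠ 0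
    rw [orient_latticePoint]
    exact_mod_cast h.slotApex_ne
  disjoint := h.disjoint_slotRegion

/-- A tile can be merged into a slot; the slot of the tile remains available. -/
theorem HasSlot.exists_merging {n k : ℕ} {G : OnePlaneGraph (Fin n)} {v w : Fin n} {r : Plane}
    (hs : G.HasSlot v w r) (hG : G.IsQuasiOptimal) {t : Tile k} (h : t.Valid) :
    ∃ G' : OnePlaneGraph (Fin (n + k)), G'.IsQuasiOptimal ∧
      G'.oddVertices = Fin.castAdd k '' symmDiff G.oddVertices {v, w} ∧
      ∃ i r', G'.HasSlot (Fin.castAdd k w) (Fin.natAdd n i) r' := by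
  -- The map takes the triangle of the tile onto the slot of G. It may reverse orientation, so slots
  -- only require a nonzero area.
  obtain ⟨A, hA, hAne, hA0, hA1, hA2⟩ := exists_affine_homeomorph h.apex_pos'.ne' hs.orient_ne
  have hvw : v ≠ w := G.graph.ne_of_adj hs.nonCrossing.1
  have hbase : t.arc s(0, 1) = segment ℝ (latticePoint (t.pt 0)) (latticePoint (t.pt 1)) :=
    h.arc_of_straight h.base_mem
  have hreg : A '' h.region = openTriangle (G.drawing.point v) (G.drawing.point w) r := by
    rw [Tile.Valid.region, hA.image_openTriangle, hA0, hA1, hA2]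
  have harc : (h.onePlaneGraph.mapHomeo A).drawing.arc s(0, 1) = A '' t.arc s(0, 1) := rfl
  have harc' : (h.onePlaneGraph.mapHomeo A).drawing.arc s(0, 1) =
      segment ℝ (G.drawing.point v) (G.drawing.point w) := by
    rw [harc, hbase, hA.image_segment, hA0, hA1]
  have himg : (h.onePlaneGraph.mapHomeo A).drawing.image = A '' h.drawing.image :=
    Drawing.image_mapHomeo _ _
  have M : MergeData G (h.onePlaneGraph.mapHomeo A) (Fin.castAddEmb k)
      ⟨glue k v w, glue_injective hvw⟩ v w 0 1
      (openTriangle (G.drawing.point v) (G.drawing.point w) r) (A '' h.below) :=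
    { nonCrossing₁ := hs.nonCrossing
      nonCrossing₂ := h.nonCrossing_base.mapHomeo A
      map_u := rfl
      map_v := rfl
      range_union := range_union_glue
      range_inter := range_inter_glue
      point_u := hA0
      point_v := hA1
      arc_eq := by rw [harc', hs.arc_eq]
      preconnected₁ := (convex_openTriangle _ _ _).isPreconnected
      nonempty₁ := openTriangle_nonempty _ _ _
      disjoint₁ := hs.disjoint
      arc_subset₁ := by
        rw [hs.arc_eq]
        exact segment_subset_closure_openTriangle _ _ _
      subset := by
        rw [himg, harc, ← hreg]
        rintro _ ⟨⟨x, hx, rfl⟩, hx'⟩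
        rcases h.image_subset hx with hx | hx
        · exact ⟨x, hx, rfl⟩
        · exact (hx' ⟨x, hx, rfl⟩).elim
      preconnected₂ :=
        (convex_halfPlane _ _).isPreconnected.image _ A.continuous.continuousOn
      not_isBounded := by
        intro hb
        apply not_isBounded_halfPlane h.apex_pos'
        -- Bounded sets pull back to bounded sets because their closures are compact.
        have hc := (hb.isCompact_closure.image A.symm.continuous).isBounded
        refine hc.subset fun x hx => ⟨A x, subset_closure ⟨x, hx, rfl⟩, by simp⟩
      disjoint₂ := by
        rw [himg]
        exact (Set.disjoint_image_iff A.injective).2 h.disjoint_below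
      arc_subset₂ := by
        rw [harc, hbase, ← A.image_closure]
        exact image_mono (segment_subset_closure_halfPlane h.apex_pos') }
  obtain ⟨i, hi⟩ : ∃ i : Fin k, t.slot = i.succ.succ := by
    have h1 := h.one_lt_slot
    revert h1
    induction t.slot using Fin.cases with
    | zero => exact fun h1 => absurd h1 (Fin.not_lt_zero _)
    | succ j =>
      induction j using Fin.cases with
      | zero => exact fun h1 => absurd h1 (lt_irrefl _)
      | succ i => exact fun _ => ⟨i, rfl⟩
  have hslot : Fin.natAdd n i = glue k v w t.slot := by rw [hi]; rfl
  have hp1 : M.merge.drawing.point (Fin.castAdd k w) = A (latticePoint (t.pt 1)) := M.point_right 1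
  have hps : M.merge.drawing.point (Fin.natAdd n i) = A (latticePoint (t.pt t.slot)) := by
    rw [hslot]
    exact M.point_right t.slot
  have hslotReg : A '' h.slotRegion = openTriangle (A (latticePoint (t.pt 1)))
      (A (latticePoint (t.pt t.slot))) (A (latticePoint t.slotApex)) := hA.image_openTriangle _ _ _
  refine ⟨M.merge, .merging _ (h.onePlaneGraph.mapHomeo A) _ hG (.optimal _ h.isOptimal)
    M.isEdgeMerging_merge, M.oddVertices_merge h.oddVertices, i, A (latticePoint t.slotApex),
    ?_, ?_, ?_, ?_⟩
  · rw [hslot]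
    exact M.nonCrossing_merge (h.nonCrossing_slot.mapHomeo A)
  · rw [hp1, hps, hslot, ← hA.image_segment, ← h.arc_of_straight h.slot_mem]
    exact M.arc_right (e := s(1, t.slot)) h.nonCrossing_slot.1
  · rw [hp1, hps]
    exact hAne _ _ _ h.hasSlot.orient_ne
  · rw [hp1, hps, ← hslotReg]
    refine Disjoint.mono_right M.image_merge (Set.disjoint_union_right.2 ⟨?_, ?_⟩)
    -- The new slot avoids G because it lies in the old slot.
    · refine hs.disjoint.mono_left ?_
      rw [← hreg]
      exact image_mono h.slotRegion_subset
    · rw [himg]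
      exact (Set.disjoint_image_iff A.injective).2 h.disjoint_slotRegion

/-- A quasi-optimal 1-plane graph on `n` vertices with exactly two vertices of odd degree, and with
a slot at one of these that allows the merging of a further tile. -/
def Extendable (n : ℕ) : Prop :=
  ∃ G : OnePlaneGraph (Fin n), G.IsQuasiOptimal ∧ G.oddVertices.ncard = 2 ∧
    ∃ v w r, G.HasSlot v w r ∧ v ∈ G.oddVertices ∧ w ∉ G.oddVertices

/-- The odd vertices are the ends 1 and `s.slot` of the merged edge. The new slot joins the second
of them to a vertex of the second tile. -/
theorem extendable_of_tiles {k l : ℕ} {s : Tile k} {t : Tile l} (hs : s.Valid) (ht : t.Valid) :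
    Extendable (k + 2 + l) := by
  obtain ⟨G, hG, hodd, i, r, hslot⟩ := hs.hasSlot.exists_merging (.optimal _ hs.isOptimal) ht
  rw [hs.oddVertices, show symmDiff (∅ : Set (Fin (k + 2))) {1, s.slot} = {1, s.slot} from
    bot_symmDiff _] at hodd
  refine ⟨G, hG, ?_, _, _, r, hslot, ?_, ?_⟩
  · rw [hodd, Set.ncard_image_of_injective _ (Fin.castAdd_injective _ _),
      Set.ncard_pair hs.one_lt_slot.ne]
  · rw [hodd]
    exact ⟨_, Or.inr rfl, rfl⟩
  · rw [hodd]
    rintro ⟨a, -, ha⟩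
    exact castAdd_ne_natAdd a i ha

/-- The odd vertex v is replaced by w, from which the new slot leads to a new, even vertex. -/
theorem Extendable.merge_tile {n k : ℕ} (hn : Extendable n) {t : Tile k} (ht : t.Valid) :
    Extendable (n + k) := by
  obtain ⟨G, hG, hcard, v, w, r, hslot, hv, hw⟩ := hn
  obtain ⟨G', hG', hodd, i, r', hslot'⟩ := hslot.exists_merging hG ht
  have hset : symmDiff G.oddVertices {v, w} = insert w (G.oddVertices \ {v}) := by
    ext x
    rw [Set.mem_symmDiff]
    by_cases h1 : x = v
    · subst h1
      have : x ≠ w := by rintro rfl; exact hw hv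
      simp [hv, this]
    · by_cases h2 : x = w
      · subst h2
        simp [hw]
      · simp [h1, h2]
  rw [hset] at hodd
  refine ⟨G', hG', ?_, _, _, r', hslot', ?_, ?_⟩
  · rw [hodd, Set.ncard_image_of_injective _ (Fin.castAdd_injective _ _),
      Set.ncard_insert_of_notMem (fun h => hw h.1), Set.ncard_sdiff_singleton_of_mem hv, hcard]
  · rw [hodd]
    exact ⟨_, Or.inl rfl, rfl⟩
  · rw [hodd]
    rintro ⟨a, -, ha⟩
    exact castAdd_ne_natAdd a i ha

theorem extendable_of_ge : ∀ n : ℕ, n = 14 ∨ 16 ≤ n → Extendable n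
  | 0, h | 1, h | 2, h | 3, h | 4, h | 5, h => by omega
  | n + 6, h => by
    by_cases h' : n = 14 ∨ 16 ≤ n
    · exact (extendable_of_ge n h').merge_tile cubeTile_valid
    -- The totals n + 6 that six fewer vertices do not supply are 14, 16, 17, 18, 19 and 21; the
    -- last occurs because 15 is not admissible.
    · obtain rfl | rfl | rfl | rfl | rfl | rfl :
          n = 8 ∨ n = 10 ∨ n = 11 ∨ n = 12 ∨ n = 13 ∨ n = 15 := by omega
      · exact extendable_of_tiles cubeTile_valid cubeTile_valid
      · exact extendable_of_tiles octagonTile_valid cubeTile_valid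
      · exact extendable_of_tiles herschelTile_valid cubeTile_valid
      · exact extendable_of_tiles decagonTile_valid cubeTile_valid
      · exact (extendable_of_tiles octagonTile_valid herschelTile_valid : Extendable (8 + 2 + 9))
      · exact (extendable_of_tiles decagonTile_valid herschelTile_valid : Extendable (10 + 2 + 9))

end OnePlaneGraph

theorem theorem1p3 (n : ℕ) (hn : n = 14 ∨ 16 ≤ n) :
    ∃ G : OnePlaneGraph (Fin n), G.IsQuasiOptimal ∧
      {v : Fin n | Odd (G.graph.neighborSet v).ncard}.ncard = 2 := by
  obtain ⟨G, hG, hodd, -⟩ := OnePlaneGraph.extendable_of_ge n hn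
  exact ⟨G, hG, hodd⟩
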